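/- Let $k$ be an algebraically closed field of characteristic $0$. Let $A$ be a smooth local commutative $k$-algebra, that is, a local commutative $k$-algebra which is formally smooth and essentially of finite type over $k$. **Notation.** For a module $M$ over a commutative ring $R$, let $L^R M$ be the free $R$-Lie algebra on $M$, graded by $L^R_0M=M$, $L^R_{n+1}M=[L^R_0M,L^R_nM]$, and put $L^R_+M=\bigoplus_{n\ge 1}L^R_nM$. The induced grading of the symmetric algebra $S^R(L^RM)$, in which a product $l_1\cdots l_r$ with $l_j\in L^R_{n_j}M$ has degree $n_1+\dots+n_r$, and that of $S^R(L^R_+M)$, are denoted by a lower index $n$. For $R=k$ we write $L$ and $S$. The symmetric algebra of a Lie algebra carries the Poisson bracket extending the Lie bracket. The Poisson envelope of $A$ is $PA=S(LA)/\langle\langle IA\rangle\rangle$, where $IA=\ker(SA\to A)$, where $SA$ is mapped to $S(LA)$ by $A=L_0A\subset LA$, and where $\langle\langle\;\rangle\rangle$ is the smallest Poisson ideal containing the given set; $P_nA$ is the image of $S_n(LA)$ in $PA$. It is an $A$-submodule of $PA$ through the canonical map $A\to PA$. **Theorem.** 1. $PA=\bigoplus_{n\ge 0}P_nA$, and for every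 $n\ge 0$ there is an isomorphism of $A$-modules $P_nA\cong S^A_n\,(L^A_+\Omega^1_A)$, where $\Omega^1_A=\Omega^1_{A/k}$. 2. There are $x_1,\dots,x_d\in A$ such that $dx_1,\dots,dx_d$ is a basis of the $A$-module $\Omega^1_A$. If the residue field of $A$ is $k$, every regular system of parameters $x_1,\dots,x_d$ of $A$ (that is, $d=\dim A$ elements which generate the maximal ideal) has this property. 3. Let $x_1,\dots,x_d\in A$ be such that $dx_1,\dots,dx_d$ is a basis of $\Omega^1_A$, and let $V=\sum_i k\,dx_i\subset\Omega^1_A$ and $Q=A\otimes_k S(L_+V)$. Let $D:Q\to Q\otimes_k LV$ be the $k$-linear map $$D(a\otimes s)=\sum_i \Big(\frac{\partial a}{\partial x_i}\otimes s\Big)\otimes dx_i+ a\otimes d_{S(L_+V)}(s),$$ where $da=\sum_i\frac{\partial a}{\partial x_i}dx_i$ and where $d_{S(L_+V)}:S(L_+V)\to S(L_+V)\otimes L_+V$ is the derivation with $l\mapsto 1\otimes l$ for $l\in L_+V$. Let $\phi(q\otimes l,q'\otimes l')=qq'[l,l']$. Then $\{p,q\}=\phi(Dp,Dq)$ is a Poisson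 bracket on $Q$, and $Q$ with the inclusion $A\to Q$, $a\mapsto a\otimes 1$, has the universal property of the Poisson envelope: every homomorphism of commutative $k$-algebras from $A$ to a Poisson $k$-algebra $P$ extends uniquely to a homomorphism of Poisson algebras $Q\to P$. Moreover, there is an isomorphism of $A$-algebras $PA\cong Q$ which is compatible with the Poisson brackets and maps $P_nA$ onto $A\otimes S_n(L_+V)$ for every $n\ge 0$. -/

import Mathlib

open scoped TensorProduct

universe u v w

noncomputable section

/-! ### Poisson algebras -/

/-- A Poisson bracket on a commutative `R`-algebra `P`: a Lie bracket over `R` which is a derivation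
in each argument. -/
structure PoissonBracket (R : Type*) (P : Type*) [CommRing R] [CommRing P] [Algebra R P] where
  /-- the bracket `{a, b}` -/
  br : P →ₗ[R] P →ₗ[R] P
  self : ∀ a, br a a = 0
  jacobi : ∀ a b c, br a (br b c) = br (br a b) c + br b (br a c)
  leibniz : ∀ a b c, br a (b * c) = br a b * c + b * br a c

namespace PoissonBracket

variable {R : Type*} {P : Type*} [CommRing R] [CommRing P] [Algebra R P]

theorem skew (B : PoissonBracket R P) (a b : P) : B.br a b = -B.br b a := by
  have h := B.self (a + b)
  simp only [map_add, LinearMap.add_apply, B.self, zero_add, add_zero] at h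
  exact eq_neg_of_add_eq_zero_right h

/-- `I` is a Poisson ideal: an ideal for the product and for the bracket. -/
def IsPoissonIdeal (B : PoissonBracket R P) (I : Ideal P) : Prop :=
  ∀ p : P, ∀ y ∈ I, B.br p y ∈ I

/-- The smallest Poisson ideal `<<Y>>` containing `Y`. -/
def idealSpan (B : PoissonBracket R P) (Y : Set P) : Ideal P :=
  sInf {I : Ideal P | B.IsPoissonIdeal I ∧ Y ⊆ I}

theorem isPoissonIdeal_idealSpan (B : PoissonBracket R P) (Y : Set P) :
    B.IsPoissonIdeal (B.idealSpan Y) := by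
  intro p y hy
  simp only [idealSpan, Submodule.mem_sInf] at hy ⊢
  intro I hI
  exact hI.1 p y (hy I hI)

theorem subset_idealSpan (B : PoissonBracket R P) (Y : Set P) : Y ⊆ B.idealSpan Y := by
  intro y hy
  simp only [idealSpan, SetLike.mem_coe, Submodule.mem_sInf]
  intro I hI
  exact hI.2 hy

/-- The bracket induced on the quotient by a Poisson ideal. -/
def quotient (B : PoissonBracket R P) (I : Ideal P) (hI : B.IsPoissonIdeal I) :
    PoissonBracket R (P ⧸ I) := by
  have key : ∀ a b a' b' : P, Ideal.Quotient.mk I a = Ideal.Quotient.mk I a' →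
      Ideal.Quotient.mk I b = Ideal.Quotient.mk I b' →
      Ideal.Quotient.mk I (B.br a b) = Ideal.Quotient.mk I (B.br a' b') := by
    intro a b a' b' ha hb
    rw [Ideal.Quotient.eq] at ha hb ⊢
    have e : B.br a b - B.br a' b' = B.br a (b - b') - B.br b' (a - a') := by
      rw [map_sub, map_sub, B.skew b' a, B.skew b' a']; ring
    rw [e]
    exact I.sub_mem (hI _ _ hb) (hI _ _ ha)
  exact
  { br := LinearMap.mk₂ R
      (fun p q => Quotient.liftOn₂' p q (fun a b => Ideal.Quotient.mk I (B.br a b))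
        (fun a b a' b' ha hb => key a b a' b' (Quotient.sound' ha) (Quotient.sound' hb)))
      (by
        rintro ⟨a⟩ ⟨b⟩ ⟨c⟩
        change Ideal.Quotient.mk I (B.br (a + b) c) =
          Ideal.Quotient.mk I (B.br a c) + Ideal.Quotient.mk I (B.br b c)
        simp)
      (by
        rintro r ⟨a⟩ ⟨b⟩
        change Ideal.Quotient.mk I (B.br (r • a) b) = r • Ideal.Quotient.mk I (B.br a b)
        rw [map_smul, LinearMap.smul_apply]
        rfl)
      (by
        rintro ⟨a⟩ ⟨b⟩ ⟨c⟩
        change Ideal.Quotient.mk I (B.br a (b + c)) =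
          Ideal.Quotient.mk I (B.br a b) + Ideal.Quotient.mk I (B.br a c)
        simp)
      (by
        rintro r ⟨a⟩ ⟨b⟩
        change Ideal.Quotient.mk I (B.br a (r • b)) = r • Ideal.Quotient.mk I (B.br a b)
        rw [map_smul]
        rfl)
    self := by
      rintro ⟨a⟩
      change Ideal.Quotient.mk I (B.br a a) = 0
      rw [B.self, map_zero]
    jacobi := by
      rintro ⟨a⟩ ⟨b⟩ ⟨c⟩
      change Ideal.Quotient.mk I (B.br a (B.br b c)) =
        Ideal.Quotient.mk I (B.br (B.br a b) c) + Ideal.Quotient.mk I (B.br b (B.br a c))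
      rw [B.jacobi, map_add]
    leibniz := by
      rintro ⟨a⟩ ⟨b⟩ ⟨c⟩
      change Ideal.Quotient.mk I (B.br a (b * c)) =
        Ideal.Quotient.mk I (B.br a b) * Ideal.Quotient.mk I c +
          Ideal.Quotient.mk I b * Ideal.Quotient.mk I (B.br a c)
      rw [B.leibniz, map_add, map_mul, map_mul] }

theorem quotient_mk (B : PoissonBracket R P) (I : Ideal P) (hI : B.IsPoissonIdeal I) (a b : P) :
    (B.quotient I hI).br (Ideal.Quotient.mk I a) (Ideal.Quotient.mk I b) =
      Ideal.Quotient.mk I (B.br a b) := rfl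

end PoissonBracket

/-- The Poisson algebra `(Q, B)` with the algebra homomorphism `i : A → Q` has the universal property
of the Poisson envelope of `A`: every algebra homomorphism from `A` to a Poisson algebra `P` extends
uniquely to a Poisson homomorphism `Q → P`. -/
def IsPoissonEnvelope {k A Q : Type*} [CommRing k] [CommRing A] [Algebra k A] [CommRing Q]
    [Algebra k Q] (B : PoissonBracket k Q) (i : A →ₐ[k] Q) : Prop :=
  ∀ (P : Type w) [CommRing P] [Algebra k P] (B' : PoissonBracket k P) (f : A →ₐ[k] P),
    ∃! g : Q →ₐ[k] P, (∀ p q, g (B.br p q) = B'.br (g p) (g q)) ∧ g.comp i = f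

/-! ### Symmetric algebras: derivations, Poisson structure, weight grading -/

section Sym

variable (R : Type*) {L : Type*} [CommRing R]

section Der

variable [AddCommGroup L] [Module R L] {N : Type*} [AddCommGroup N] [Module R N]
  [Module (SymmetricAlgebra R L) N]

/-- The derivation of the symmetric algebra `SL` with values in an `SL`-module `N` which
extends a given linear map `L → N`. -/
def symDer [IsScalarTower R (SymmetricAlgebra R L) N] (φ : L →ₗ[R] N) : Derivation R (SymmetricAlgebra R L) N :=
  letI : Module (SymmetricAlgebra R L)ᵐᵒᵖ N :=
    Module.compHom N ((RingHom.id (SymmetricAlgebra R L)).fromOpposite fun _ _ => mul_comm _ _)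
  haveI : IsCentralScalar (SymmetricAlgebra R L) N := ⟨fun _ _ => rfl⟩
  haveI : IsScalarTower R (SymmetricAlgebra R L)ᵐᵒᵖ N :=
    ⟨fun r s n => by
      change (r • s.unop) • n = r • (s.unop • n)
      exact smul_assoc _ _ _⟩
  let F : SymmetricAlgebra R L →ₐ[R] TrivSqZeroExt (SymmetricAlgebra R L) N :=
    SymmetricAlgebra.lift
      ((TrivSqZeroExt.inlAlgHom R (SymmetricAlgebra R L) N).toLinearMap ∘ₗ SymmetricAlgebra.ι R L +
        (TrivSqZeroExt.inrHom (SymmetricAlgebra R L) N).restrictScalars R ∘ₗ φ)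
  have hF : ∀ s, (F s).fst = s := by
    have : (TrivSqZeroExt.fstHom R (SymmetricAlgebra R L) N).comp F = AlgHom.id R _ := by
      apply SymmetricAlgebra.algHom_ext
      ext l
      simp [F]
    intro s
    exact DFunLike.congr_fun this s
  Derivation.mk' ((TrivSqZeroExt.sndHom (SymmetricAlgebra R L) N).restrictScalars R ∘ₗ F.toLinearMap)
    (by
      intro a b
      change (F (a * b)).snd = a • (F b).snd + b • (F a).snd
      rw [map_mul, TrivSqZeroExt.snd_mul, hF, hF]
      rfl)

@[simp]
theorem symDer_ι [IsScalarTower R (SymmetricAlgebra R L) N] (φ : L →ₗ[R] N) (l : L) : symDer R φ (SymmetricAlgebra.ι R L l) = φ l := by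
  simp [symDer]

variable {R}

theorem symDer_ext {D D' : Derivation R (SymmetricAlgebra R L) N}
    (h : ∀ l, D (SymmetricAlgebra.ι R L l) = D' (SymmetricAlgebra.ι R L l)) : D = D' := by
  ext s
  induction s using SymmetricAlgebra.induction with
  | algebraMap r => simp
  | ι l => exact h l
  | mul a b ha hb => simp [ha, hb]
  | add a b ha hb => simp [ha, hb]

end Der

variable [LieRing L] [LieAlgebra R L]

/-- The derivation `{l, -}` of `SL`, for `l` in the Lie algebra `L`. -/
def symAd : L →ₗ[R] Derivation R (SymmetricAlgebra R L) (SymmetricAlgebra R L) where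
  toFun l := symDer R (SymmetricAlgebra.ι R L ∘ₗ (LieAlgebra.ad R L l : L →ₗ[R] L))
  map_add' l l' := symDer_ext fun m => by simp
  map_smul' r l := symDer_ext fun m => by simp

variable (L) in
/-- The biderivation of `SL` which extends the Lie bracket of `L`. -/
def symBr : SymmetricAlgebra R L →ₗ[R] SymmetricAlgebra R L →ₗ[R] SymmetricAlgebra R L where
  toFun p := (symDer R (symAd R (L := L)) p).toLinearMap
  map_add' p q := by ext; simp
  map_smul' r p := by ext; simp

open SymmetricAlgebra in
@[simp]
theorem symBr_ι (l m : L) : symBr R L (ι R L l) (ι R L m) = ι R L ⁅l, m⁆ := by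
  simp [symBr, symAd]

theorem symBr_mul_left (a b c : SymmetricAlgebra R L) :
    symBr R L (a * b) c = a * symBr R L b c + b * symBr R L a c := by
  simp [symBr]

theorem symBr_mul_right (a b c : SymmetricAlgebra R L) :
    symBr R L a (b * c) = b * symBr R L a c + c * symBr R L a b := by
  simp [symBr]

theorem symBr_algebraMap_left (r : R) (c : SymmetricAlgebra R L) :
    symBr R L (algebraMap R _ r) c = 0 := by
  simp [symBr]

theorem symBr_algebraMap_right (r : R) (c : SymmetricAlgebra R L) :
    symBr R L c (algebraMap R _ r) = 0 := by
  simp [symBr]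

theorem symBr_skew (a b : SymmetricAlgebra R L) : symBr R L a b = -symBr R L b a := by
  induction a using SymmetricAlgebra.induction with
  | algebraMap r => simp [symBr_algebraMap_left, symBr_algebraMap_right]
  | mul a a' h h' => rw [symBr_mul_left, symBr_mul_right, h, h']; ring
  | add a a' h h' => simp only [map_add, LinearMap.add_apply, h, h']; ring
  | ι l =>
    induction b using SymmetricAlgebra.induction with
    | algebraMap r => simp [symBr_algebraMap_left, symBr_algebraMap_right]
    | mul a a' h h' => rw [symBr_mul_left, symBr_mul_right, h, h']; ring
    | add a a' h h' => simp only [map_add, LinearMap.add_apply, h, h']; ring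
    | ι m => rw [symBr_ι, symBr_ι, ← map_neg, lie_skew]

theorem symBr_self (a : SymmetricAlgebra R L) : symBr R L a a = 0 := by
  induction a using SymmetricAlgebra.induction with
  | algebraMap r => simp [symBr_algebraMap_left]
  | ι l => simp
  | mul a b h h' =>
    simp only [symBr_mul_left, symBr_mul_right, h, h', symBr_skew R b a]; ring
  | add a b h h' =>
    simp only [map_add, LinearMap.add_apply, h, h', symBr_skew R b a]; ring

theorem symBr_jacobi (a b c : SymmetricAlgebra R L) :
    symBr R L a (symBr R L b c) =
      symBr R L (symBr R L a b) c + symBr R L b (symBr R L a c) := by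
  induction a using SymmetricAlgebra.induction with
  | algebraMap r => simp [symBr_algebraMap_left]
  | mul a a' h h' =>
    simp only [symBr_mul_left, symBr_mul_right, map_add, LinearMap.add_apply, h, h',
      symBr_skew R b a, symBr_skew R b a']
    ring
  | add a a' h h' => simp only [map_add, LinearMap.add_apply, h, h']; ring
  | ι l =>
    induction b using SymmetricAlgebra.induction with
    | algebraMap r => simp [symBr_algebraMap_left, symBr_algebraMap_right]
    | mul b b' h h' =>
      simp only [symBr_mul_left, symBr_mul_right, map_add, LinearMap.add_apply, h, h']
      ring
    | add b b' h h' => simp only [map_add, LinearMap.add_apply, h, h']; ring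
    | ι m =>
      induction c using SymmetricAlgebra.induction with
      | algebraMap r => simp [symBr_algebraMap_right]
      | mul c c' h h' =>
        simp only [symBr_mul_right, map_add, h, h']
        ring
      | add b b' h h' => simp only [map_add, h, h']; ring
      | ι n => simp only [symBr_ι, ← map_add]; rw [leibniz_lie]

variable (L) in
/-- The Poisson structure on the symmetric algebra of a Lie algebra `L`: the unique Poisson bracket
extending the Lie bracket of `L`. -/
def symPoisson : PoissonBracket R (SymmetricAlgebra R L) where
  br := symBr R L
  self := symBr_self R
  jacobi := symBr_jacobi R
  leibniz a b c := by rw [symBr_mul_right]; ring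

end Sym

/-- The degree `n` part of `SL`, for the grading induced by a grading `ℒ` of `L`: it is spanned by
the products `l₁ ⋯ l_r` with `l_j ∈ ℒ (n_j)` and `n₁ + ⋯ + n_r = n`. -/
def symGrade (R : Type*) {L : Type*} [CommRing R] [AddCommGroup L] [Module R L]
    (ℒ : ℕ → Submodule R L) (n : ℕ) : Submodule R (SymmetricAlgebra R L) :=
  Submodule.span R {s | ∃ m : Multiset (ℕ × L), (∀ p ∈ m, p.2 ∈ ℒ p.1) ∧
    (m.map Prod.fst).sum = n ∧ s = (m.map fun p => SymmetricAlgebra.ι R L p.2).prod}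

/-! ### The free Lie algebra on a module -/

section FreeLie

variable (R : Type*) (M : Type*) [CommRing R] [AddCommGroup M] [Module R M]

/-- The ideal of the free Lie algebra on the set `M` which makes the inclusion of `M` linear. -/
def freeLieRel : LieIdeal R (FreeLieAlgebra R M) :=
  LieSubmodule.lieSpan R (FreeLieAlgebra R M)
    ({z | ∃ m m' : M, z = FreeLieAlgebra.of R (m + m') -
        (FreeLieAlgebra.of R m + FreeLieAlgebra.of R m')} ∪
      {z | ∃ (r : R) (m : M), z = FreeLieAlgebra.of R (r • m) - r • FreeLieAlgebra.of R m})

/-- The free `R`-Lie algebra on the `R`-module `M` (the left adjoint of the forgetful functor from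
`R`-Lie algebras to `R`-modules, applied to `M`). -/
def FreeLie : Type _ := FreeLieAlgebra R M ⧸ freeLieRel R M

instance : LieRing (FreeLie R M) :=
  inferInstanceAs (LieRing (FreeLieAlgebra R M ⧸ freeLieRel R M))

instance : LieAlgebra R (FreeLie R M) :=
  inferInstanceAs (LieAlgebra R (FreeLieAlgebra R M ⧸ freeLieRel R M))

namespace FreeLie

/-- The canonical map `M → LM`. -/
def ι : M →ₗ[R] FreeLie R M where
  toFun m := LieSubmodule.Quotient.mk (N := freeLieRel R M) (FreeLieAlgebra.of R m)
  map_add' m m' := (Submodule.Quotient.eq _).2 <|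
    LieSubmodule.subset_lieSpan (Or.inl ⟨m, m', rfl⟩)
  map_smul' r m := (Submodule.Quotient.eq _).2 <|
    LieSubmodule.subset_lieSpan (Or.inr ⟨r, m, rfl⟩)

/-- The grading of `LM`, with `M` in degree `0`: `L₀ = M` and `Lₙ₊₁ = [L₀, Lₙ]`. -/
def grade : ℕ → Submodule R (FreeLie R M)
  | 0 => LinearMap.range (ι R M)
  | n + 1 => Submodule.span R {z | ∃ m : M, ∃ l ∈ grade n, z = ⁅ι R M m, l⁆}

/-- `L₊M`, the sum of the `LₙM` with `n ≥ 1`. -/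
def plus : Submodule R (FreeLie R M) := ⨆ n : ℕ, grade R M (n + 1)

/-- The grading of `L₊M`. -/
def plusGrade (n : ℕ) : Submodule R (plus R M) := (grade R M n).comap (plus R M).subtype

theorem iSup_grade : ⨆ n : ℕ, grade R M n = ⊤ := by
  let S : Submodule R (FreeLie R M) := ⨆ n : ℕ, grade R M n
  have hle : ∀ n, grade R M n ≤ S := fun n => le_iSup (grade R M) n
  have h1 : ∀ (m : M), ∀ l ∈ S, ⁅ι R M m, l⁆ ∈ S := by
    intro m l hl
    induction hl using Submodule.iSup_induction' with
    | mem n x hx => exact hle (n + 1) (Submodule.subset_span ⟨m, x, hx, rfl⟩)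
    | zero => simp
    | add x y _ _ hx hy => rw [lie_add]; exact S.add_mem hx hy
  have h2 : ∀ n, ∀ x ∈ grade R M n, ∀ l ∈ S, ⁅x, l⁆ ∈ S := by
    intro n
    induction n with
    | zero => rintro x ⟨m, rfl⟩ l hl; exact h1 m l hl
    | succ n ih =>
      intro x hx l hl
      induction hx using Submodule.span_induction with
      | mem x hx =>
        obtain ⟨m, y, hy, rfl⟩ := hx
        rw [lie_lie]
        exact S.sub_mem (h1 m _ (ih y hy l hl)) (ih y hy _ (h1 m l hl))
      | zero => simp
      | add x y _ _ hx hy => rw [add_lie]; exact S.add_mem hx hy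
      | smul r x _ hx => rw [smul_lie]; exact S.smul_mem r hx
  have h3 : ∀ x ∈ S, ∀ l ∈ S, ⁅x, l⁆ ∈ S := by
    intro x hx l hl
    induction hx using Submodule.iSup_induction' with
    | mem n x hx => exact h2 n x hx l hl
    | zero => simp
    | add x y _ _ hx hy => rw [add_lie]; exact S.add_mem hx hy
  let T : LieSubalgebra R (FreeLie R M) := { S with lie_mem' := fun {x y} hx hy => h3 x hx y hy }
  let q : FreeLieAlgebra R M →ₗ⁅R⁆ FreeLie R M :=
    { toFun := fun x => LieSubmodule.Quotient.mk (N := freeLieRel R M) x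
      map_add' := fun _ _ => rfl
      map_smul' := fun _ _ => rfl
      map_lie' := fun {_ _} => rfl }
  have hm : ∀ m, ι R M m ∈ T := fun m => hle 0 ⟨m, rfl⟩
  let j : FreeLieAlgebra R M →ₗ⁅R⁆ T := FreeLieAlgebra.lift R fun m => ⟨ι R M m, hm m⟩
  have hj : T.incl.comp j = q := by
    apply FreeLieAlgebra.hom_ext
    intro m
    rw [LieHom.comp_apply, FreeLieAlgebra.lift_of_apply]
    rfl
  rw [eq_top_iff]
  intro x _
  obtain ⟨y, rfl⟩ : ∃ y, q y = x := LieSubmodule.Quotient.surjective_mk' (freeLieRel R M) x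
  rw [← hj]
  exact (j y).2

/-- Every bracket lies in `L₊M`. -/
theorem lie_mem_plus (x y : FreeLie R M) : ⁅x, y⁆ ∈ plus R M := by
  have hle : ∀ n, grade R M (n + 1) ≤ plus R M := fun n => le_iSup (fun n => grade R M (n + 1)) n
  have h1 : ∀ (m : M) (l : FreeLie R M), ⁅ι R M m, l⁆ ∈ plus R M := by
    intro m l
    have hl : l ∈ ⨆ n : ℕ, grade R M n := by rw [iSup_grade]; trivial
    induction hl using Submodule.iSup_induction' with
    | mem n x hx => exact hle n (Submodule.subset_span ⟨m, x, hx, rfl⟩)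
    | zero => simp
    | add x y _ _ hx hy => rw [lie_add]; exact add_mem hx hy
  have hx : x ∈ ⨆ n : ℕ, grade R M n := by rw [iSup_grade]; trivial
  induction hx using Submodule.iSup_induction' with
  | mem n x hx =>
    induction n generalizing x y with
    | zero => obtain ⟨m, rfl⟩ := hx; exact h1 m y
    | succ n ih =>
      induction hx using Submodule.span_induction with
      | mem x hx =>
        obtain ⟨m, z, hz, rfl⟩ := hx
        rw [lie_lie]
        exact sub_mem (h1 m _) (ih _ _ hz)
      | zero => simp
      | add x y _ _ hx hy => rw [add_lie]; exact add_mem hx hy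
      | smul r x _ hx => rw [smul_lie]; exact Submodule.smul_mem _ r hx
  | zero => simp
  | add x y _ _ hx hy => rw [add_lie]; exact add_mem hx hy

/-- The bracket of `LM` as a bilinear map with values in `L₊M`. -/
def lieToPlus : FreeLie R M →ₗ[R] FreeLie R M →ₗ[R] plus R M :=
  LinearMap.mk₂ R (fun x y => ⟨⁅x, y⁆, lie_mem_plus R M x y⟩)
    (fun _ _ _ => Subtype.ext (add_lie _ _ _)) (fun _ _ _ => Subtype.ext (smul_lie _ _ _))
    (fun _ _ _ => Subtype.ext (lie_add _ _ _)) (fun _ _ _ => Subtype.ext (lie_smul _ _ _))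

end FreeLie

end FreeLie

/-! ### The Poisson envelope -/

section Envelope

variable (k : Type u) (A : Type v) [CommRing k] [CommRing A] [Algebra k A]

/-- The kernel `IA` of the canonical projection `SA → A`, where `SA` is the symmetric algebra of the
underlying `k`-module of `A`. -/
def kerSym : Ideal (SymmetricAlgebra k A) :=
  RingHom.ker (SymmetricAlgebra.lift (LinearMap.id : A →ₗ[k] A))

/-- The inclusion `SA → SLA`. -/
def symToSymLie : SymmetricAlgebra k A →ₐ[k] SymmetricAlgebra k (FreeLie k A) :=
  SymmetricAlgebra.lift (SymmetricAlgebra.ι k (FreeLie k A) ∘ₗ FreeLie.ι k A)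

/-- The Poisson ideal `<<IA>>` of `SLA`. -/
def envelopeIdeal : Ideal (SymmetricAlgebra k (FreeLie k A)) :=
  (symPoisson k (FreeLie k A)).idealSpan (symToSymLie k A '' (kerSym k A))

/-- The Poisson envelope `PA = SLA / <<IA>>` of the commutative `k`-algebra `A`. -/
def PoissonEnvelope : Type _ := SymmetricAlgebra k (FreeLie k A) ⧸ envelopeIdeal k A

namespace PoissonEnvelope

instance : CommRing (PoissonEnvelope k A) :=
  inferInstanceAs (CommRing (SymmetricAlgebra k (FreeLie k A) ⧸ envelopeIdeal k A))

instance instAlgebraBase : Algebra k (PoissonEnvelope k A) :=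
  inferInstanceAs (Algebra k (SymmetricAlgebra k (FreeLie k A) ⧸ envelopeIdeal k A))

/-- The projection `SLA → PA`. -/
def mk : SymmetricAlgebra k (FreeLie k A) →ₐ[k] PoissonEnvelope k A :=
  Ideal.Quotient.mkₐ k (envelopeIdeal k A)

/-- The Poisson bracket of `PA`. -/
def poisson : PoissonBracket k (PoissonEnvelope k A) :=
  (symPoisson k (FreeLie k A)).quotient (envelopeIdeal k A)
    (PoissonBracket.isPoissonIdeal_idealSpan _ _)

theorem mk_symToSymLie_eq {p q : SymmetricAlgebra k A}
    (h : SymmetricAlgebra.lift (LinearMap.id : A →ₗ[k] A) p =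
      SymmetricAlgebra.lift (LinearMap.id : A →ₗ[k] A) q) :
    mk k A (symToSymLie k A p) = mk k A (symToSymLie k A q) := by
  refine Ideal.Quotient.eq.2 (PoissonBracket.subset_idealSpan _ _ ⟨p - q, ?_, by simp⟩)
  simp [kerSym, RingHom.mem_ker, h]

/-- The canonical algebra homomorphism `A = SA / IA → PA`. -/
def incl : A →ₐ[k] PoissonEnvelope k A :=
  AlgHom.ofLinearMap
    ((mk k A).toLinearMap ∘ₗ (symToSymLie k A).toLinearMap ∘ₗ SymmetricAlgebra.ι k A)
    (by
      have := mk_symToSymLie_eq k A (p := SymmetricAlgebra.ι k A 1) (q := 1) (by simp)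
      simpa using this)
    (by
      intro a b
      have := mk_symToSymLie_eq k A (p := SymmetricAlgebra.ι k A (a * b))
        (q := SymmetricAlgebra.ι k A a * SymmetricAlgebra.ι k A b) (by simp)
      simpa using this)

/-- `PA` as an `A`-algebra. -/
instance instAlgebra : Algebra A (PoissonEnvelope k A) := (incl k A).toRingHom.toAlgebra

/-- The homogeneous part `PₙA`: the image of the degree `n` part `SₙLA` of `SLA`. It is an
`A`-submodule of `PA`. -/
def grade (n : ℕ) : Submodule A (PoissonEnvelope k A) where
  carrier := mk k A '' (symGrade k (FreeLie.grade k A) n : Set (SymmetricAlgebra k (FreeLie k A)))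
  add_mem' := by
    rintro _ _ ⟨s, hs, rfl⟩ ⟨t, ht, rfl⟩
    exact ⟨s + t, add_mem hs ht, map_add _ _ _⟩
  zero_mem' := ⟨0, zero_mem _, map_zero _⟩
  smul_mem' := by
    rintro a _ ⟨s, hs, rfl⟩
    refine ⟨SymmetricAlgebra.ι k (FreeLie k A) (FreeLie.ι k A a) * s, ?_, ?_⟩
    · rw [SetLike.mem_coe, symGrade] at hs ⊢
      induction hs using Submodule.span_induction with
      | mem s hs =>
        obtain ⟨m, hm, rfl, rfl⟩ := hs
        refine Submodule.subset_span ⟨(0, FreeLie.ι k A a) ::ₘ m, ?_, by simp, by simp⟩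
        intro p hp
        rcases Multiset.mem_cons.1 hp with rfl | hp
        · exact ⟨a, rfl⟩
        · exact hm p hp
      | zero => simp
      | add x y _ _ hx hy => rw [mul_add]; exact add_mem hx hy
      | smul r x _ hx => rw [mul_smul_comm]; exact Submodule.smul_mem _ r hx
    · rw [Algebra.smul_def, map_mul]
      congr 1
      change _ = mk k A (symToSymLie k A (SymmetricAlgebra.ι k A a))
      rw [symToSymLie, SymmetricAlgebra.lift_ι_apply]
      rfl

end PoissonEnvelope

end Envelope

/-! ### The explicit model in local coordinates -/

section Model

variable (k : Type u) {A : Type v} [CommRing k] [CommRing A] [Algebra k A] {d : ℕ}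

/-- The differentials `dx₁, …, dx_d` form a basis of the `A`-module `Ω¹_A`. -/
structure IsCoordinateSystem (x : Fin d → A) : Prop where
  linearIndependent : LinearIndependent A fun i => KaehlerDifferential.D k A (x i)
  span_eq_top : ⊤ ≤ Submodule.span A (Set.range fun i => KaehlerDifferential.D k A (x i))

/-- `x₁, …, x_d` is a regular system of parameters of the local ring `A`: `d` is the dimension of `A`
and `x₁, …, x_d` generate the maximal ideal. -/
def IsRegularSystemOfParameters [IsLocalRing A] (x : Fin d → A) : Prop :=
  ringKrullDim A = d ∧ Ideal.span (Set.range x) = IsLocalRing.maximalIdeal A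

/-- The `k`-subspace `V = ∑ k dxᵢ` of `Ω¹_A`. -/
def dSpan (x : Fin d → A) : Submodule k (Ω[A⁄k]) :=
  Submodule.span k (Set.range fun i => KaehlerDifferential.D k A (x i))

/-- The basis `dx₁, …, dx_d` of `Ω¹_A`. -/
def IsCoordinateSystem.basis {x : Fin d → A} (h : IsCoordinateSystem k x) :
    Module.Basis (Fin d) A (Ω[A⁄k]) :=
  Module.Basis.mk h.linearIndependent h.span_eq_top

/-- The de Rham differential of `A` as a map `A → A ⊗ V = Ω¹_A`: it sends `a` to
`∑ (∂a/∂xᵢ) ⊗ dxᵢ`, where `da = ∑ (∂a/∂xᵢ) dxᵢ`. -/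
def deRhamCoord {x : Fin d → A} (h : IsCoordinateSystem k x) : A →ₗ[k] A ⊗[k] dSpan k x :=
  ∑ i, (TensorProduct.mk k A (dSpan k x)).flip
      ⟨KaehlerDifferential.D k A (x i), Submodule.subset_span ⟨i, rfl⟩⟩ ∘ₗ
    ((h.basis k).coord i).restrictScalars k ∘ₗ (KaehlerDifferential.D k A).toLinearMap

/-- `SL₊V`. -/
abbrev SymLiePlus (x : Fin d → A) := SymmetricAlgebra k (FreeLie.plus k (dSpan k x))

/-- The algebra `A ⊗ SL₊V`. -/
abbrev EnvelopeModel (x : Fin d → A) := A ⊗[k] SymLiePlus k x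

/-- The de Rham differential `SL₊V → Ω¹ = SL₊V ⊗ L₊V` of the symmetric algebra `SL₊V`: the
derivation which sends `l` to `1 ⊗ l`. -/
def deRhamSym (x : Fin d → A) :
    SymLiePlus k x →ₗ[k] SymLiePlus k x ⊗[k] FreeLie.plus k (dSpan k x) :=
  (symDer k (TensorProduct.mk k (SymLiePlus k x) (FreeLie.plus k (dSpan k x)) 1)).toLinearMap

/-- The derivation `D = τ ∘ (d_A ⊗ id) + id ⊗ d_{SL₊V}` from `A ⊗ SL₊V` to
`A ⊗ SL₊V ⊗ LV`, with `τ` the permutation `A ⊗ V ⊗ SL₊V → A ⊗ SL₊V ⊗ V`. -/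
def modelD {x : Fin d → A} (h : IsCoordinateSystem k x) :
    EnvelopeModel k x →ₗ[k] EnvelopeModel k x ⊗[k] FreeLie k (dSpan k x) :=
  (FreeLie.ι k (dSpan k x)).lTensor (EnvelopeModel k x) ∘ₗ
      (TensorProduct.rightComm k A (dSpan k x) (SymLiePlus k x)).toLinearMap ∘ₗ
      (deRhamCoord k h).rTensor (SymLiePlus k x) +
    (FreeLie.plus k (dSpan k x)).subtype.lTensor (EnvelopeModel k x) ∘ₗ
      (TensorProduct.assoc k A (SymLiePlus k x) (FreeLie.plus k (dSpan k x))).symm.toLinearMap ∘ₗ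
      (deRhamSym k x).lTensor A

/-- The map `φ = id ⊗ [,]`: it sends `(q ⊗ l, q' ⊗ l')` to `q q' [l, l']`. -/
def modelPhi (x : Fin d → A) :
    EnvelopeModel k x ⊗[k] FreeLie k (dSpan k x) →ₗ[k]
      EnvelopeModel k x ⊗[k] FreeLie k (dSpan k x) →ₗ[k] EnvelopeModel k x :=
  (TensorProduct.map₂ (LinearMap.mul k (EnvelopeModel k x))
      ((FreeLie.lieToPlus k (dSpan k x)).compr₂
        ((Algebra.TensorProduct.includeRight : SymLiePlus k x →ₐ[k] EnvelopeModel k x).toLinearMap ∘ₗ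
          SymmetricAlgebra.ι k (FreeLie.plus k (dSpan k x))))).compr₂
    (LinearMap.mul' k (EnvelopeModel k x))

/-- The bracket `{p, q} = φ(Dp ∧ Dq)` on `A ⊗ SL₊V`. -/
def modelBr {x : Fin d → A} (h : IsCoordinateSystem k x) :
    EnvelopeModel k x →ₗ[k] EnvelopeModel k x →ₗ[k] EnvelopeModel k x :=
  (modelPhi k x).compl₁₂ (modelD k h) (modelD k h)

end Model

end

/-! Coordinates $x_i$ identify $\Omega^1_A$ with $A\otimes V$ in such a way that every $v\in V$ is
the differential of an element of $A$; `DiffCoord` keeps only this. It follows that a derivation of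
$A$ along an algebra homomorphism vanishes once it vanishes on the coordinate functions. So a
derivation of $Q=A\otimes S(L_+V)$ is determined by its restriction to the image of `lieGen`, the
map $LV\to Q$ that sends $dx_i$ to $x_i\otimes 1$ and $l\in L_+V$ to $1\otimes l$
(`lieModel_derivation_eq_zero`).

Since $D$ sends the image of $l\in LV$ to $1\otimes l$, the bracket $\phi(Dp,Dq)$ restricts along
`lieGen` to the Lie bracket of $LV$ (`lieD_lieGen`, `lieBr_lieGen`). The Jacobi identity therefore
holds on these elements, and the detection principle carries it to $Q$ (`jacobi_of_generators`).
Given $A\to P$, freeness of $LV$ produces a Lie homomorphism $LV\to P$ from the images of the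
coordinates; its restriction to $L_+V$, together with $A\to P$, defines $Q\to P$. Compatibility with
the brackets is again checked only on $LV$ (`map_bracket_of_generators`). As $PA$ has the same
universal property, $PA\cong Q$.

The isomorphism respects the gradings because bracketing with an element of $A$ raises the degree in
$Q$ by one, and because the image of $LV$ in $Q$ comes from $LA$ (`exists_equiv`). The sum of the
homogeneous parts is direct because they lie in eigenspaces for the distinct eigenvalues $2^n$ of an
endomorphism (`isInternal_of_pow_smul`). The description by $S^A(L^A_+\Omega^1_A)$ follows since
free Lie algebras and symmetric algebras commute with base change.

Coordinates exist by extracting a basis from the generators $da$ of the flat module $\Omega^1_A$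
over the local ring $A$. For a regular system of parameters, Nakayama's lemma shows that the $dx_i$
span, and $d=\dim A\le\dim\mathfrak m/\mathfrak m^2\le\operatorname{rank}\Omega^1_A$ makes them
independent. -/

noncomputable section

open TensorProduct

/-! ### Free Lie algebras -/

namespace FreeLie

section Basic

variable (R : Type*) (M : Type*) [CommRing R] [AddCommGroup M] [Module R M]
variable {L : Type*} [LieRing L] [LieAlgebra R L]

/-- The quotient map from the free Lie algebra on the set `M`. -/
def mkHom : FreeLieAlgebra R M →ₗ⁅R⁆ FreeLie R M :=
  { toFun := fun x => LieSubmodule.Quotient.mk (N := freeLieRel R M) x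
    map_add' := fun _ _ => rfl
    map_smul' := fun _ _ => rfl
    map_lie' := fun {_ _} => rfl }

theorem mkHom_surjective : Function.Surjective (mkHom R M) :=
  LieSubmodule.Quotient.surjective_mk' (freeLieRel R M)

variable {R M}

/-- A submodule which contains the generators and is stable under bracketing with them is
everything. -/
theorem eq_top_of_lie_mem (S : Submodule R (FreeLie R M)) (h0 : ∀ m, ι R M m ∈ S)
    (h1 : ∀ m, ∀ l ∈ S, ⁅ι R M m, l⁆ ∈ S) : S = ⊤ := by
  rw [eq_top_iff, ← iSup_grade, iSup_le_iff]
  intro n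
  induction n with
  | zero => rintro _ ⟨m, rfl⟩; exact h0 m
  | succ n ih =>
    refine Submodule.span_le.2 ?_
    rintro _ ⟨m, l, hl, rfl⟩
    exact h1 m l (ih hl)

theorem freeLieRel_le_ker (f : M →ₗ[R] L) :
    freeLieRel R M ≤ (FreeLieAlgebra.lift R (f : M → L)).ker := by
  refine LieSubmodule.lieSpan_le.2 ?_
  rintro z (⟨m, m', rfl⟩ | ⟨r, m, rfl⟩)
  · simp [LieHom.mem_ker, FreeLieAlgebra.lift_of_apply]
  · simp [LieHom.mem_ker, FreeLieAlgebra.lift_of_apply]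

/-- The universal property of the free Lie algebra on a module. -/
def lift (f : M →ₗ[R] L) : FreeLie R M →ₗ⁅R⁆ L :=
  { (freeLieRel R M).toSubmodule.liftQ (FreeLieAlgebra.lift R (f : M → L)).toLinearMap
      (fun _ hx => LieHom.mem_ker.1 (freeLieRel_le_ker f hx)) with
    map_lie' := by
      intro x y
      obtain ⟨x, rfl⟩ := mkHom_surjective R M x
      obtain ⟨y, rfl⟩ := mkHom_surjective R M y
      exact LieHom.map_lie (FreeLieAlgebra.lift R (f : M → L)) x y }

@[simp]
theorem lift_ι (f : M →ₗ[R] L) (m : M) : lift f (ι R M m) = f m :=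
  FreeLieAlgebra.lift_of_apply (f : M → L) m

theorem lieHom_ext {f g : FreeLie R M →ₗ⁅R⁆ L} (h : ∀ m, f (ι R M m) = g (ι R M m)) : f = g := by
  have : LinearMap.eqLocus (f : FreeLie R M →ₗ[R] L) (g : FreeLie R M →ₗ[R] L) = ⊤ := by
    refine eq_top_of_lie_mem _ h fun m l hl => ?_
    rw [LinearMap.mem_eqLocus] at hl ⊢
    simp only [LieHom.coe_toLinearMap, LieHom.map_lie] at hl ⊢
    rw [h, hl]
  ext l
  have hl : l ∈ LinearMap.eqLocus (f : FreeLie R M →ₗ[R] L) (g : FreeLie R M →ₗ[R] L) := by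
    rw [this]; trivial
  exact hl

variable {N : Type*} [AddCommGroup N] [Module R N]

/-- The functoriality of the free Lie algebra. -/
def map (f : M →ₗ[R] N) : FreeLie R M →ₗ⁅R⁆ FreeLie R N := lift (ι R N ∘ₗ f)

@[simp]
theorem map_ι (f : M →ₗ[R] N) (m : M) : map f (ι R M m) = ι R N (f m) := by simp [map]

theorem map_mem_grade (f : M →ₗ[R] N) {n : ℕ} {l : FreeLie R M} (hl : l ∈ grade R M n) :
    map f l ∈ grade R N n := by
  induction n generalizing l with
  | zero => obtain ⟨m, rfl⟩ := hl; exact ⟨f m, (map_ι f m).symm⟩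
  | succ n ih =>
    induction hl using Submodule.span_induction with
    | mem x hx =>
      obtain ⟨m, l, hl, rfl⟩ := hx
      rw [LieHom.map_lie, map_ι]
      exact Submodule.subset_span ⟨_, _, ih hl, rfl⟩
    | zero => simp
    | add x y _ _ hx hy => rw [map_add]; exact add_mem hx hy
    | smul r x _ hx => rw [map_smul]; exact Submodule.smul_mem _ r hx

theorem grade_succ_le_plus (n : ℕ) : grade R M (n + 1) ≤ plus R M :=
  le_iSup (fun n => grade R M (n + 1)) n

/-- The abelian Lie ring on an additive group. -/
abbrev abelianLieRing (M : Type*) [AddCommGroup M] : LieRing M :=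
  { bracket := fun _ _ => 0
    add_lie := fun _ _ _ => (add_zero 0).symm
    lie_add := fun _ _ _ => (add_zero 0).symm
    lie_self := fun _ => rfl
    leibniz_lie := fun _ _ _ => (add_zero 0).symm }

/-- The abelian Lie algebra on a module. -/
abbrev abelianLieAlgebra (R M : Type*) [CommRing R] [AddCommGroup M] [Module R M] :
    @LieAlgebra R M _ (abelianLieRing M) :=
  letI := abelianLieRing M
  { lie_smul := fun r _ _ => (smul_zero r).symm }

variable (R M)

/-- The projection of `LM` onto `L₀M = M`. -/
def proj : FreeLie R M →ₗ[R] M :=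
  -- With the zero bracket on `M`, the identity of `M` extends to a Lie homomorphism, which
  -- automatically kills all brackets.
  letI := abelianLieRing M
  letI := abelianLieAlgebra R M
  (lift (LinearMap.id : M →ₗ[R] M) : FreeLie R M →ₗ⁅R⁆ M).toLinearMap

variable {R M}

@[simp]
theorem proj_ι (m : M) : proj R M (ι R M m) = m := by
  let _ := abelianLieRing M
  let _ := abelianLieAlgebra R M
  exact lift_ι (LinearMap.id : M →ₗ[R] M) m

@[simp]
theorem proj_lie (x y : FreeLie R M) : proj R M ⁅x, y⁆ = 0 := by
  let _ := abelianLieRing M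
  let _ := abelianLieAlgebra R M
  exact LieHom.map_lie (lift (LinearMap.id : M →ₗ[R] M) : FreeLie R M →ₗ⁅R⁆ M) x y

theorem proj_eq_zero {l : FreeLie R M} (hl : l ∈ plus R M) : proj R M l = 0 := by
  have : plus R M ≤ LinearMap.ker (proj R M) := by
    refine iSup_le fun n => Submodule.span_le.2 ?_
    rintro _ ⟨m, l, -, rfl⟩
    exact proj_lie _ _
  exact this hl

/-- Generators give zero and brackets already lie in `plus`. With `proj_eq_zero` this yields the
splitting $LM=M\oplus L_+M$. -/
theorem sub_ι_proj_mem (l : FreeLie R M) : l - ι R M (proj R M l) ∈ plus R M := by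
  have : (plus R M).comap (LinearMap.id - ι R M ∘ₗ proj R M) = ⊤ := by
    refine eq_top_of_lie_mem _ (fun m => ?_) fun m l _ => ?_
    · simp
    · simpa using lie_mem_plus R M _ _
  have hl : l ∈ (plus R M).comap (LinearMap.id - ι R M ∘ₗ proj R M) := by rw [this]; trivial
  exact hl

variable (R M)

/-- The projection of `LM` onto `L₊M`. -/
def plusProj : FreeLie R M →ₗ[R] plus R M :=
  LinearMap.codRestrict (plus R M) (LinearMap.id - ι R M ∘ₗ proj R M) sub_ι_proj_mem

variable {R M}

theorem coe_plusProj (l : FreeLie R M) : (plusProj R M l : FreeLie R M) = l - ι R M (proj R M l) :=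
  rfl

@[simp]
theorem plusProj_ι (m : M) : plusProj R M (ι R M m) = 0 := by
  ext; simp [coe_plusProj]

@[simp]
theorem plusProj_coe (l : plus R M) : plusProj R M l = l := by
  ext; simp [coe_plusProj, proj_eq_zero l.2]

theorem ι_proj_add_plusProj (l : FreeLie R M) : ι R M (proj R M l) + plusProj R M l = l := by
  rw [coe_plusProj]; abel

/-- Degree zero consists of generators, which `proj` recovers, while `proj` vanishes on $L_+M$. -/
theorem plusGrade_zero : plusGrade R M 0 = ⊥ := by
  rw [eq_bot_iff]
  rintro ⟨l, hl⟩ ⟨m, hm : ι R M m = l⟩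
  have := proj_eq_zero hl
  rw [← hm, proj_ι] at this
  subst this
  simpa using hm.symm

theorem plusProj_mem_plusGrade {n : ℕ} {l : FreeLie R M} (hl : l ∈ grade R M n) :
    plusProj R M l ∈ plusGrade R M n := by
  cases n with
  | zero => obtain ⟨m, rfl⟩ := hl; simp
  | succ n =>
    rw [show plusProj R M l = ⟨l, grade_succ_le_plus n hl⟩ from
      plusProj_coe ⟨l, grade_succ_le_plus n hl⟩]
    exact hl

theorem iSup_plusGrade : ⨆ n, plusGrade R M n = ⊤ := by
  rw [eq_top_iff]
  rintro l -
  have : (⊤ : Submodule R (FreeLie R M)) ≤ (⨆ n, plusGrade R M n).comap (plusProj R M) := by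
    rw [← iSup_grade]
    exact iSup_le fun n l hl => le_iSup (plusGrade R M) n (plusProj_mem_plusGrade hl)
  simpa using this (Submodule.mem_top : (l : FreeLie R M) ∈ ⊤)

end Basic

/-! ### Scalar multiplication of the generators -/

section Scale

variable {R M : Type*} [CommRing R] [AddCommGroup M] [Module R M]

/-- The exponent is `n + 1` because $L_nM$ is spanned by brackets of $n+1$ generators. -/
theorem map_smul_id_apply (c : R) {n : ℕ} {l : FreeLie R M} (hl : l ∈ grade R M n) :
    map (c • (LinearMap.id : M →ₗ[R] M)) l = c ^ (n + 1) • l := by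
  induction n generalizing l with
  | zero => obtain ⟨m, rfl⟩ := hl; simp
  | succ n ih =>
    induction hl using Submodule.span_induction with
    | mem x hx =>
      obtain ⟨m, l, hl, rfl⟩ := hx
      rw [LieHom.map_lie, map_ι, ih hl]
      simp only [LinearMap.smul_apply, LinearMap.id_apply, map_smul, smul_lie, lie_smul, smul_smul]
      congr 1
      ring
    | zero => simp
    | add x y _ _ hx hy => rw [map_add, hx, hy, smul_add]
    | smul r x _ hx => rw [map_smul, hx, smul_comm]

end Scale

end FreeLie

/-! ### The weight grading of symmetric algebras -/

section SymGrade

variable {R L : Type*} [CommRing R] [AddCommGroup L] [Module R L] (ℒ : ℕ → Submodule R L)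

instance symGrade.gradedMonoid : SetLike.GradedMonoid (symGrade R ℒ) where
  one_mem := Submodule.subset_span ⟨0, by simp, by simp, by simp⟩
  mul_mem := by
    intro i j x y hx hy
    have : symGrade R ℒ i * symGrade R ℒ j ≤ symGrade R ℒ (i + j) := by
      rw [symGrade, symGrade, Submodule.span_mul_span, Submodule.span_le]
      rintro _ ⟨_, ⟨m, hm, rfl, rfl⟩, _, ⟨m', hm', rfl, rfl⟩, rfl⟩
      refine Submodule.subset_span ⟨m + m', ?_, by simp, by simp⟩
      intro p hp
      rcases Multiset.mem_add.1 hp with hp | hp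
      exacts [hm p hp, hm' p hp]
    exact this (Submodule.mul_mem_mul hx hy)

theorem ι_mem_symGrade {n : ℕ} {l : L} (hl : l ∈ ℒ n) : SymmetricAlgebra.ι R L l ∈ symGrade R ℒ n :=
  Submodule.subset_span ⟨{(n, l)}, by simpa using hl, by simp, by simp⟩

/-- A multiplicative map with values in a graded algebra is graded if it is so on generators. -/
theorem symGrade_le {B : Type*} [CommRing B] [Algebra R B] (F : SymmetricAlgebra R L →ₐ[R] B)
    {σ : Type*} [SetLike σ B] [AddSubmonoidClass σ B]
    (ℬ : ℕ → σ) [SetLike.GradedMonoid ℬ] (hs : ∀ n (r : R), ∀ b ∈ ℬ n, r • b ∈ ℬ n)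
    (h : ∀ n, ∀ l ∈ ℒ n, F (SymmetricAlgebra.ι R L l) ∈ ℬ n) {n : ℕ} {s : SymmetricAlgebra R L}
    (hn : s ∈ symGrade R ℒ n) : F s ∈ ℬ n := by
  induction hn using Submodule.span_induction with
  | mem s hs =>
    obtain ⟨m, hm, rfl, rfl⟩ := hs
    induction m using Multiset.induction_on with
    | empty => simpa using SetLike.GradedOne.one_mem (A := ℬ)
    | cons p m ih =>
      simp only [Multiset.map_cons, Multiset.prod_cons, Multiset.sum_cons, map_mul]
      exact SetLike.GradedMul.mul_mem (h _ _ (hm p (Multiset.mem_cons_self p m)))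
        (ih fun q hq => hm q (Multiset.mem_cons_of_mem hq))
  | zero => rw [map_zero]; exact zero_mem _
  | add x y _ _ hx hy => rw [map_add]; exact add_mem hx hy
  | smul r x _ hx => rw [map_smul]; exact hs _ _ _ hx

/-- The sum of the homogeneous parts is closed under products and contains the scalars and the
generators. -/
theorem iSup_symGrade (h : ⨆ n, ℒ n = ⊤) : ⨆ n, symGrade R ℒ n = ⊤ := by
  have hmul : ∀ x ∈ ⨆ n, symGrade R ℒ n, ∀ y ∈ ⨆ n, symGrade R ℒ n,
      x * y ∈ ⨆ n, symGrade R ℒ n := by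
    intro x hx y hy
    have : (⨆ n, symGrade R ℒ n) * (⨆ n, symGrade R ℒ n) ≤ ⨆ n, symGrade R ℒ n := by
      simp only [Submodule.iSup_mul, Submodule.mul_iSup]
      exact iSup_le fun i => iSup_le fun j => le_trans
        (Submodule.mul_le.2 fun a ha b hb => SetLike.GradedMul.mul_mem ha hb)
        (le_iSup (symGrade R ℒ) (j + i))
    exact this (Submodule.mul_mem_mul hx hy)
  rw [eq_top_iff]
  rintro s -
  induction s using SymmetricAlgebra.induction with
  | algebraMap r =>
    rw [Algebra.algebraMap_eq_smul_one]
    exact Submodule.smul_mem _ _ (le_iSup (symGrade R ℒ) 0 SetLike.GradedOne.one_mem)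
  | ι l =>
    have : ⨆ n, ℒ n ≤ (⨆ n, symGrade R ℒ n).comap (SymmetricAlgebra.ι R L) :=
      iSup_le fun n l hl => le_iSup (symGrade R ℒ) n (ι_mem_symGrade ℒ hl)
    rw [h] at this
    exact this Submodule.mem_top
  | mul a b ha hb => exact hmul a ha b hb
  | add a b ha hb => exact add_mem ha hb

/-- If `τ` acts on the generators of degree `n` by `c ^ n`, so does the induced endomorphism of the
symmetric algebra. -/
theorem lift_eq_pow_smul (c : R) (τ : L →ₗ[R] L) (hτ : ∀ n, ∀ l ∈ ℒ n, τ l = c ^ n • l) {n : ℕ}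
    {s : SymmetricAlgebra R L} (hn : s ∈ symGrade R ℒ n) :
    SymmetricAlgebra.lift (SymmetricAlgebra.ι R L ∘ₗ τ) s = c ^ n • s := by
  induction hn using Submodule.span_induction with
  | mem s hs =>
    obtain ⟨m, hm, rfl, rfl⟩ := hs
    induction m using Multiset.induction_on with
    | empty => simp
    | cons p m ih =>
      simp only [Multiset.map_cons, Multiset.prod_cons, Multiset.sum_cons, map_mul]
      rw [ih fun q hq => hm q (Multiset.mem_cons_of_mem hq), SymmetricAlgebra.lift_ι_apply,
        LinearMap.comp_apply, hτ _ _ (hm p (Multiset.mem_cons_self p m)), map_smul,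
        smul_mul_smul_comm, pow_add]
  | zero => simp
  | add x y _ _ hx hy => rw [map_add, hx, hy, smul_add]
  | smul r x _ hx => rw [map_smul, hx, smul_comm]

end SymGrade

/-- Multiplication by `c` on `M` induces $c^{n+1}$ in degree `n`; dividing by `c` corrects the
exponent, so that the action becomes multiplicative in the degree and extends to the symmetric
algebra. -/
theorem FreeLie.exists_plus_scaling (k M : Type*) [Field k] [AddCommGroup M] [Module k M] (c : k)
    (hc : c ≠ 0) : ∃ τ : plus k M →ₗ[k] plus k M, ∀ n, ∀ l ∈ plusGrade k M n, τ l = c ^ n • l := by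
  refine ⟨c⁻¹ • plusProj k M ∘ₗ (map (c • LinearMap.id)).toLinearMap ∘ₗ (plus k M).subtype, ?_⟩
  intro n l hl
  have h := map_smul_id_apply c (show (l : FreeLie k M) ∈ grade k M n from hl)
  simp only [LinearMap.smul_apply, LinearMap.comp_apply, Submodule.subtype_apply,
    LieHom.coe_toLinearMap]
  rw [h, map_smul, plusProj_coe, smul_smul, pow_succ', inv_mul_cancel_left₀ hc]

/-! ### Lie homomorphisms into Poisson algebras -/

namespace PoissonBracket

variable {R P : Type*} [CommRing R] [CommRing P] [Algebra R P] (B : PoissonBracket R P)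

/-- The Lie ring underlying a Poisson algebra. -/
abbrev lieRing : LieRing P :=
  { bracket := fun a b => B.br a b
    add_lie := fun a b c => by
      change B.br (a + b) c = B.br a c + B.br b c
      rw [map_add, LinearMap.add_apply]
    lie_add := fun a b c => map_add (B.br a) b c
    lie_self := B.self
    leibniz_lie := B.jacobi }

/-- The Lie algebra underlying a Poisson algebra. -/
abbrev lieAlgebra : @LieAlgebra R P _ B.lieRing :=
  letI := B.lieRing
  { lie_smul := fun r a b => map_smul (B.br a) r b }

theorem leibniz_left (a b c : P) : B.br (a * b) c = a * B.br b c + b * B.br a c := by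
  rw [B.skew, B.leibniz, B.skew c a, B.skew c b]; ring

end PoissonBracket

namespace FreeLie

variable {R M P : Type*} [CommRing R] [AddCommGroup M] [Module R M] [CommRing P] [Algebra R P]

/-- The Lie homomorphism from the free Lie algebra to a Poisson algebra extending a linear map. -/
def liftPoisson (B : PoissonBracket R P) (f : M →ₗ[R] P) : FreeLie R M →ₗ[R] P :=
  letI := B.lieRing
  letI := B.lieAlgebra
  (lift f : FreeLie R M →ₗ⁅R⁆ P).toLinearMap

@[simp]
theorem liftPoisson_ι (B : PoissonBracket R P) (f : M →ₗ[R] P) (m : M) :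
    liftPoisson B f (ι R M m) = f m :=
  let _ := B.lieRing
  let _ := B.lieAlgebra
  lift_ι f m

theorem liftPoisson_lie (B : PoissonBracket R P) (f : M →ₗ[R] P) (x y : FreeLie R M) :
    liftPoisson B f ⁅x, y⁆ = B.br (liftPoisson B f x) (liftPoisson B f y) :=
  let _ := B.lieRing
  let _ := B.lieAlgebra
  LieHom.map_lie (lift f : FreeLie R M →ₗ⁅R⁆ P) x y

/-- Lie homomorphisms from a free Lie algebra to a Poisson algebra are determined by their
restriction to the generators. -/
theorem linearMap_ext_of_lie (B : PoissonBracket R P) {f g : FreeLie R M →ₗ[R] P}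
    (hf : ∀ x y, f ⁅x, y⁆ = B.br (f x) (f y)) (hg : ∀ x y, g ⁅x, y⁆ = B.br (g x) (g y))
    (h : ∀ m, f (ι R M m) = g (ι R M m)) : f = g := by
  have : LinearMap.eqLocus f g = ⊤ := by
    refine eq_top_of_lie_mem _ h fun m l hl => ?_
    rw [LinearMap.mem_eqLocus] at hl ⊢
    rw [hf, hg, h, hl]
  ext l
  have hl : l ∈ LinearMap.eqLocus f g := by rw [this]; trivial
  exact hl

end FreeLie

/-- Both sides are biderivations along `F`, so induction in each argument reduces the identity to
generators. -/
theorem lift_symBr {R L P : Type*} [CommRing R] [LieRing L] [LieAlgebra R L] [CommRing P]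
    [Algebra R P] (B : PoissonBracket R P) (F : SymmetricAlgebra R L →ₐ[R] P)
    (hF : ∀ l m, F (SymmetricAlgebra.ι R L ⁅l, m⁆) =
      B.br (F (SymmetricAlgebra.ι R L l)) (F (SymmetricAlgebra.ι R L m)))
    (p q : SymmetricAlgebra R L) : F (symBr R L p q) = B.br (F p) (F q) := by
  have br_one : ∀ p, B.br p 1 = 0 := fun p => by
    have := B.leibniz p 1 1
    simpa using this
  have br_alg : ∀ p r, B.br p (algebraMap R P r) = 0 := fun p r => by
    rw [Algebra.algebraMap_eq_smul_one, map_smul, br_one, smul_zero]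
  induction p using SymmetricAlgebra.induction with
  | algebraMap r => rw [symBr_algebraMap_left, B.skew]; simp [br_alg]
  | mul a b ha hb => rw [symBr_mul_left, map_add, map_mul, map_mul, ha, hb, map_mul, B.leibniz_left]
  | add a b ha hb => simp only [map_add, LinearMap.add_apply, ha, hb]
  | ι l =>
    induction q using SymmetricAlgebra.induction with
    | algebraMap r => rw [symBr_algebraMap_right]; simp [br_alg]
    | mul a b ha hb =>
      rw [symBr_mul_right, map_add, map_mul, map_mul, ha, hb, map_mul, B.leibniz]; ring
    | add a b ha hb => simp only [map_add, ha, hb]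
    | ι m => rw [symBr_ι, hF]

/-! ### The universal property of the Poisson envelope -/

namespace PoissonEnvelope

variable (k : Type u) (A : Type v) [CommRing k] [CommRing A] [Algebra k A]

theorem mk_surjective : Function.Surjective (mk k A) := Ideal.Quotient.mk_surjective

theorem mk_symBr (p q : SymmetricAlgebra k (FreeLie k A)) :
    mk k A (symBr k _ p q) = (poisson k A).br (mk k A p) (mk k A q) := rfl

theorem mk_ι_ι (a : A) :
    mk k A (SymmetricAlgebra.ι k _ (FreeLie.ι k A a)) = incl k A a := by
  change _ = mk k A (symToSymLie k A (SymmetricAlgebra.ι k A a))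
  rw [symToSymLie, SymmetricAlgebra.lift_ι_apply]
  rfl

/-- The Lie homomorphism `LA → PA`. -/
def ofLie : FreeLie k A →ₗ[k] PoissonEnvelope k A :=
  (mk k A).toLinearMap ∘ₗ SymmetricAlgebra.ι k (FreeLie k A)

theorem ofLie_ι (a : A) : ofLie k A (FreeLie.ι k A a) = incl k A a := mk_ι_ι k A a

theorem ofLie_lie (x y : FreeLie k A) :
    ofLie k A ⁅x, y⁆ = (poisson k A).br (ofLie k A x) (ofLie k A y) := by
  simp only [ofLie, LinearMap.comp_apply, AlgHom.toLinearMap_apply]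
  rw [← mk_symBr, symBr_ι]

variable {k A}

theorem algHom_ext' {P : Type*} [CommRing P] [Algebra k P] {f g : PoissonEnvelope k A →ₐ[k] P}
    (h : ∀ l, f (ofLie k A l) = g (ofLie k A l)) : f = g := by
  have : f.comp (mk k A) = g.comp (mk k A) := SymmetricAlgebra.algHom_ext (LinearMap.ext h)
  ext p
  obtain ⟨p, rfl⟩ := mk_surjective k A p
  exact DFunLike.congr_fun this p

/-- Composes three universal properties: free Lie algebra, symmetric algebra, quotient. -/
theorem isPoissonEnvelope : IsPoissonEnvelope.{w} (poisson k A) (incl k A) := by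
  intro P _ _ B f
  let ψ := FreeLie.liftPoisson B f.toLinearMap
  let F : SymmetricAlgebra k (FreeLie k A) →ₐ[k] P := SymmetricAlgebra.lift ψ
  have hFι : ∀ l, F (SymmetricAlgebra.ι k _ l) = ψ l := SymmetricAlgebra.lift_ι_apply ψ
  have hF : ∀ p q, F (symBr k _ p q) = B.br (F p) (F q) :=
    lift_symBr B F fun l m => by rw [hFι, hFι, hFι, FreeLie.liftPoisson_lie]
  -- The kernel of a bracket-preserving homomorphism is a Poisson ideal, and it contains $IA$
  -- because `f` is multiplicative; hence it contains the smallest such ideal.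
  have hle : envelopeIdeal k A ≤ RingHom.ker F := by
    refine sInf_le ⟨fun p y hy => ?_, ?_⟩
    · rw [RingHom.mem_ker] at hy ⊢
      exact (hF p y).trans (by rw [hy, map_zero])
    · rintro _ ⟨s, hs, rfl⟩
      have : F.comp (symToSymLie k A) = f.comp (SymmetricAlgebra.lift (LinearMap.id : A →ₗ[k] A)) := by
        apply SymmetricAlgebra.algHom_ext
        ext a
        simp [symToSymLie, hFι, ψ]
      rw [SetLike.mem_coe, RingHom.mem_ker]
      have h2 := DFunLike.congr_fun this s
      rw [AlgHom.comp_apply, AlgHom.comp_apply] at h2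
      rw [h2, show SymmetricAlgebra.lift (LinearMap.id : A →ₗ[k] A) s = 0 from hs, map_zero]
  let g : PoissonEnvelope k A →ₐ[k] P := Ideal.Quotient.liftₐ (envelopeIdeal k A) F hle
  have hg : ∀ s, g (mk k A s) = F s := fun s => rfl
  refine ⟨g, ⟨fun p q => ?_, ?_⟩, ?_⟩
  · obtain ⟨p, rfl⟩ := mk_surjective k A p
    obtain ⟨q, rfl⟩ := mk_surjective k A q
    rw [← mk_symBr, hg, hg, hg, hF]
  · ext a
    rw [AlgHom.comp_apply, ← mk_ι_ι, hg, hFι, FreeLie.liftPoisson_ι]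
    rfl
  · rintro g' ⟨h1, h2⟩
    refine algHom_ext' fun l => ?_
    have : g'.toLinearMap ∘ₗ ofLie k A = ψ := by
      refine FreeLie.linearMap_ext_of_lie B (fun x y => ?_) (FreeLie.liftPoisson_lie B _) fun a => ?_
      · simp only [LinearMap.comp_apply, AlgHom.toLinearMap_apply, ofLie_lie, h1]
      · simp only [LinearMap.comp_apply, AlgHom.toLinearMap_apply, ofLie_ι, ψ,
          FreeLie.liftPoisson_ι, ← h2, AlgHom.comp_apply]
    have h3 := DFunLike.congr_fun this l
    exact h3.trans (hFι l).symm

instance : IsScalarTower k A (PoissonEnvelope k A) :=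
  IsScalarTower.of_algebraMap_eq fun r => ((incl k A).commutes r).symm

theorem ofLie_mem_grade {n : ℕ} {l : FreeLie k A} (hl : l ∈ FreeLie.grade k A n) :
    ofLie k A l ∈ grade k A n :=
  ⟨_, ι_mem_symGrade _ hl, rfl⟩

instance : SetLike.GradedMonoid (grade k A) where
  one_mem := ⟨1, SetLike.GradedOne.one_mem, map_one _⟩
  mul_mem := by
    rintro i j _ _ ⟨s, hs, rfl⟩ ⟨t, ht, rfl⟩
    exact ⟨s * t, SetLike.GradedMul.mul_mem hs ht, map_mul _ _ _⟩

end PoissonEnvelope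

/-! ### Coordinates -/

/-- Coordinates on the `k`-algebra `A` parametrised by a `k`-module `V`: an isomorphism
`A ⊗ V ≃ Ω¹_A` such that the image of each `v` in `V` is the differential of some `σ v`. -/
structure DiffCoord (k A V : Type*) [CommRing k] [CommRing A] [Algebra k A] [AddCommGroup V]
    [Module k V] where
  /-- the trivialisation of the module of differentials -/
  equiv : A ⊗[k] V ≃ₗ[A] Ω[A⁄k]
  /-- the coordinate functions -/
  primitive : V →ₗ[k] A
  equiv_tmul : ∀ v, equiv (1 ⊗ₜ v) = KaehlerDifferential.D k A (primitive v)

namespace DiffCoord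

variable {k A V : Type*} [CommRing k] [CommRing A] [Algebra k A] [AddCommGroup V] [Module k V]

/-- The de Rham differential `A → Ω¹_A = A ⊗ V`. -/
def deRham (c : DiffCoord k A V) : Derivation k A (A ⊗[k] V) :=
  c.equiv.symm.toLinearMap.compDer (KaehlerDifferential.D k A)

theorem deRham_apply (c : DiffCoord k A V) (a : A) :
    c.deRham a = c.equiv.symm (KaehlerDifferential.D k A a) := rfl

@[simp]
theorem deRham_primitive (c : DiffCoord k A V) (v : V) : c.deRham (c.primitive v) = 1 ⊗ₜ v := by
  rw [deRham_apply, ← c.equiv_tmul, LinearEquiv.symm_apply_apply]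

/-- A derivation along an algebra homomorphism vanishes if it vanishes on the coordinates. -/
theorem derivation_eq_zero (c : DiffCoord k A V) {P : Type*} [CommRing P] [Algebra k P]
    (f : A →ₐ[k] P) (D : A →ₗ[k] P) (hD : ∀ a b, D (a * b) = f a * D b + f b * D a)
    (h0 : ∀ v, D (c.primitive v) = 0) (a : A) : D a = 0 := by
  -- Through `f`, `P` becomes an `A`-module and `D` a true derivation, which factors through
  -- $\Omega^1_A$.
  let _ : Algebra A P := f.toRingHom.toAlgebra
  have : IsScalarTower k A P := IsScalarTower.of_algebraMap_eq fun r => (f.commutes r).symm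
  let D' : Derivation k A P := Derivation.mk' D fun a b => by
    rw [Algebra.smul_def, Algebra.smul_def]; exact hD a b
  have hD' : ∀ a, D'.liftKaehlerDifferential (KaehlerDifferential.D k A a) = D a :=
    D'.liftKaehlerDifferential_comp_D
  have key : D'.liftKaehlerDifferential ∘ₗ c.equiv.toLinearMap = 0 := by
    refine TensorProduct.AlgebraTensorModule.ext fun a v => ?_
    have h1 : D'.liftKaehlerDifferential (c.equiv (1 ⊗ₜ v)) = 0 := by
      rw [c.equiv_tmul, hD', h0]
    rw [show a ⊗ₜ[k] v = a • (1 ⊗ₜ v) by rw [smul_tmul', smul_eq_mul, mul_one]]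
    rw [map_smul, LinearMap.comp_apply, LinearEquiv.coe_toLinearMap, h1, smul_zero]
    simp
  have := DFunLike.congr_fun key (c.deRham a)
  rw [LinearMap.comp_apply, LinearEquiv.coe_toLinearMap, deRham_apply,
    LinearEquiv.apply_symm_apply, hD'] at this
  exact this

end DiffCoord

/-! ### Derivations of tensor products and brackets -/

section ProductDerivation

variable {k A S V L N : Type*} [CommRing k] [CommRing A] [Algebra k A] [CommRing S] [Algebra k S]
  [AddCommGroup V] [Module k V] [AddCommGroup L] [Module k L] [AddCommGroup N] [Module k N]

/-- The map `a ⊗ v ↦ (a ⊗ s) ⊗ f v`. -/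
def tmulMiddle (f : V →ₗ[k] N) (s : S) : A ⊗[k] V →ₗ[k] (A ⊗[k] S) ⊗[k] N :=
  f.lTensor (A ⊗[k] S) ∘ₗ (TensorProduct.rightComm k A V S).toLinearMap ∘ₗ
    (TensorProduct.mk k (A ⊗[k] V) S).flip s

@[simp]
theorem tmulMiddle_tmul (f : V →ₗ[k] N) (s : S) (a : A) (v : V) :
    tmulMiddle f s (a ⊗ₜ[k] v) = (a ⊗ₜ[k] s) ⊗ₜ[k] f v := rfl

theorem tmulMiddle_mul_smul (f : V →ₗ[k] N) (a : A) (s s' : S) (t : A ⊗[k] V) :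
    tmulMiddle f (s * s') (a • t) = (a ⊗ₜ[k] s) • tmulMiddle f s' t := by
  induction t with
  | zero => rw [smul_zero, map_zero, map_zero, smul_zero]
  | tmul b v =>
    rw [TensorProduct.smul_tmul', tmulMiddle_tmul, tmulMiddle_tmul, TensorProduct.smul_tmul',
      smul_eq_mul, smul_eq_mul, Algebra.TensorProduct.tmul_mul_tmul]
  | add t t' ht ht' => rw [smul_add, map_add, map_add, smul_add, ht, ht']

/-- The map `s ⊗ l ↦ (a ⊗ s) ⊗ g l`. -/
def tmulLeft (g : L →ₗ[k] N) (a : A) : S ⊗[k] L →ₗ[k] (A ⊗[k] S) ⊗[k] N :=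
  g.lTensor (A ⊗[k] S) ∘ₗ (TensorProduct.assoc k A S L).symm.toLinearMap ∘ₗ TensorProduct.mk k A _ a

@[simp]
theorem tmulLeft_tmul (g : L →ₗ[k] N) (a : A) (s : S) (l : L) :
    tmulLeft g a (s ⊗ₜ l) = (a ⊗ₜ[k] s) ⊗ₜ[k] g l := rfl

theorem tmulLeft_mul_smul (g : L →ₗ[k] N) (a b : A) (s : S) (t : S ⊗[k] L) :
    tmulLeft g (a * b) (s • t) = (a ⊗ₜ[k] s) • tmulLeft g b t := by
  induction t with
  | zero => rw [smul_zero, map_zero, map_zero, smul_zero]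
  | tmul u l =>
    rw [TensorProduct.smul_tmul', tmulLeft_tmul, tmulLeft_tmul, TensorProduct.smul_tmul',
      smul_eq_mul, smul_eq_mul, Algebra.TensorProduct.tmul_mul_tmul]
  | add t t' ht ht' => rw [smul_add, map_add, map_add, smul_add, ht, ht']

/-- The derivation of a tensor product of algebras defined by derivations of the factors. -/
def productD (dA : A →ₗ[k] A ⊗[k] V) (dS : S →ₗ[k] S ⊗[k] L) (f : V →ₗ[k] N) (g : L →ₗ[k] N) :
    A ⊗[k] S →ₗ[k] (A ⊗[k] S) ⊗[k] N :=
  f.lTensor (A ⊗[k] S) ∘ₗ (TensorProduct.rightComm k A V S).toLinearMap ∘ₗ dA.rTensor S +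
    g.lTensor (A ⊗[k] S) ∘ₗ (TensorProduct.assoc k A S L).symm.toLinearMap ∘ₗ dS.lTensor A

theorem productD_tmul (dA : A →ₗ[k] A ⊗[k] V) (dS : S →ₗ[k] S ⊗[k] L) (f : V →ₗ[k] N)
    (g : L →ₗ[k] N) (a : A) (s : S) :
    productD dA dS f g (a ⊗ₜ s) = tmulMiddle f s (dA a) + tmulLeft g a (dS s) := rfl

/-- On pure tensors each of the two summands of `productD` obeys the Leibniz rule, by the
semilinearity of `tmulMiddle` and `tmulLeft`. -/
theorem productD_mul (dA : Derivation k A (A ⊗[k] V)) (dS : Derivation k S (S ⊗[k] L))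
    (f : V →ₗ[k] N) (g : L →ₗ[k] N) (p q : A ⊗[k] S) :
    productD (dA : A →ₗ[k] _) (dS : S →ₗ[k] _) f g (p * q) =
      p • productD (dA : A →ₗ[k] _) (dS : S →ₗ[k] _) f g q +
        q • productD (dA : A →ₗ[k] _) (dS : S →ₗ[k] _) f g p := by
  induction p with
  | zero => simp
  | add p p' hp hp' => rw [add_mul, map_add, map_add, hp, hp', add_smul, smul_add]; abel
  | tmul a s =>
    induction q with
    | zero => simp
    | add q q' hq hq' => rw [mul_add, map_add, map_add, hq, hq', add_smul, smul_add]; abel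
    | tmul b t =>
      simp only [Algebra.TensorProduct.tmul_mul_tmul, productD_tmul, Derivation.coeFn_coe,
        Derivation.leibniz, map_add, smul_add]
      rw [tmulLeft_mul_smul, mul_comm a b, tmulLeft_mul_smul, tmulMiddle_mul_smul, mul_comm s t,
        tmulMiddle_mul_smul]
      abel

end ProductDerivation

/-! ### Extension of bilinear maps to free modules over an algebra -/

section Pairing

variable {k Q N : Type*} [CommRing k] [CommRing Q] [Algebra k Q] [AddCommGroup N] [Module k N]

/-- The `Q`-bilinear extension `(q ⊗ l, q' ⊗ l') ↦ q q' β (l, l')` of a bilinear map. -/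
def extendPairing (β : N →ₗ[k] N →ₗ[k] Q) : Q ⊗[k] N →ₗ[k] Q ⊗[k] N →ₗ[k] Q :=
  (TensorProduct.map₂ (LinearMap.mul k Q) β).compr₂ (LinearMap.mul' k Q)

theorem extendPairing_tmul (β : N →ₗ[k] N →ₗ[k] Q) (p q : Q) (l m : N) :
    extendPairing β (p ⊗ₜ l) (q ⊗ₜ m) = (p * q) * β l m := rfl

theorem extendPairing_smul_right (β : N →ₗ[k] N →ₗ[k] Q) (q : Q) (t t' : Q ⊗[k] N) :
    extendPairing β t (q • t') = q * extendPairing β t t' := by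
  induction t with
  | zero => simp
  | add t u ht hu => simp only [map_add, LinearMap.add_apply, ht, hu, mul_add]
  | tmul p l =>
    induction t' with
    | zero => simp
    | add t u ht hu => simp only [smul_add, map_add, ht, hu, mul_add]
    | tmul p' l' =>
      rw [TensorProduct.smul_tmul', extendPairing_tmul, extendPairing_tmul, smul_eq_mul]
      ring

theorem extendPairing_skew (β : N →ₗ[k] N →ₗ[k] Q) (hβ : ∀ l m, β l m = -β m l) (t t' : Q ⊗[k] N) :
    extendPairing β t t' = -extendPairing β t' t := by
  induction t with
  | zero => simp
  | add t u ht hu => simp only [map_add, LinearMap.add_apply, ht, hu, neg_add]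
  | tmul p l =>
    induction t' with
    | zero => simp
    | add t u ht hu => simp only [map_add, LinearMap.add_apply, ht, hu, neg_add]
    | tmul p' l' =>
      rw [extendPairing_tmul, extendPairing_tmul, hβ]
      ring

theorem extendPairing_self (β : N →ₗ[k] N →ₗ[k] Q) (h0 : ∀ l, β l l = 0)
    (hβ : ∀ l m, β l m = -β m l) (t : Q ⊗[k] N) : extendPairing β t t = 0 := by
  induction t with
  | zero => simp
  | add t u ht hu =>
    simp only [map_add, LinearMap.add_apply, ht, hu, extendPairing_skew β hβ u t]
    ring
  | tmul p l => rw [extendPairing_tmul, h0, mul_zero]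

end Pairing

/-! ### Bracket identities checked on generators -/

section BiderivationJacobi

variable {k Q : Type*} [CommRing k] [CommRing Q] [Algebra k Q]

/-- A skew biderivation satisfies the Jacobi identity if it does so on a set `X` such that
derivations which vanish on `X` vanish. -/
theorem jacobi_of_generators (b : Q →ₗ[k] Q →ₗ[k] Q) (skew : ∀ p q, b p q = -b q p)
    (leib : ∀ p q r, b p (q * r) = q * b p r + r * b p q) (X : Set Q)
    (hX : ∀ D : Q →ₗ[k] Q, (∀ p q, D (p * q) = p * D q + q * D p) → (∀ y ∈ X, D y = 0) →
      ∀ p, D p = 0)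
    (gen : ∀ u ∈ X, ∀ v ∈ X, ∀ w ∈ X, b u (b v w) = b (b u v) w + b v (b u w)) (p q r : Q) :
    b p (b q r) = b (b p q) r + b q (b p r) := by
  have leib' : ∀ p q r, b (p * q) r = p * b q r + q * b p r := fun p q r => by
    rw [skew, leib, skew q, skew p]; ring
  -- The Jacobiator is a derivation in each argument. The three applications of `hX` free the third,
  -- the second and finally the first argument from `X`.
  have h3 : ∀ u ∈ X, ∀ v ∈ X, ∀ r, b u (b v r) = b (b u v) r + b v (b u r) := by
    intro u hu v hv r
    rw [← sub_eq_zero]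
    refine hX (b u ∘ₗ b v - (b (b u v) + b v ∘ₗ b u)) (fun p q => ?_) (fun w hw => ?_) r
    · simp only [LinearMap.sub_apply, LinearMap.add_apply, LinearMap.comp_apply, leib, map_add]
      ring
    · exact sub_eq_zero.2 (gen u hu v hv w hw)
  have h2 : ∀ u ∈ X, ∀ q r, b u (b q r) = b (b u q) r + b q (b u r) := by
    intro u hu q r
    rw [← sub_eq_zero]
    refine hX (b u ∘ₗ b.flip r - (b.flip r ∘ₗ b u + b.flip (b u r))) (fun p q => ?_)
      (fun w hw => ?_) q
    · simp only [LinearMap.sub_apply, LinearMap.add_apply, LinearMap.comp_apply,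
        LinearMap.flip_apply, leib, leib', map_add]
      ring
    · exact sub_eq_zero.2 (h3 u hu w hw r)
  rw [← sub_eq_zero]
  refine hX (b.flip (b q r) - (b.flip r ∘ₗ b.flip q + b q ∘ₗ b.flip r)) (fun p p' => ?_)
    (fun w hw => ?_) p
  · simp only [LinearMap.sub_apply, LinearMap.add_apply, LinearMap.comp_apply,
      LinearMap.flip_apply, leib, leib', map_add, skew q p, skew q p']
    ring
  · exact sub_eq_zero.2 (h2 w hw q r)

/-- An algebra homomorphism is compatible with skew biderivations if it is so on a set `X` such that
derivations which vanish on `X` vanish. -/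
theorem map_bracket_of_generators {P : Type*} [CommRing P] [Algebra k P] (b : Q →ₗ[k] Q →ₗ[k] Q)
    (skew : ∀ p q, b p q = -b q p) (leib : ∀ p q r, b p (q * r) = q * b p r + r * b p q)
    (B : PoissonBracket k P) (g : Q →ₐ[k] P) (X : Set Q)
    (hX : ∀ D : Q →ₗ[k] P, (∀ p q, D (p * q) = g p * D q + g q * D p) → (∀ y ∈ X, D y = 0) →
      ∀ p, D p = 0)
    (gen : ∀ u ∈ X, ∀ v ∈ X, g (b u v) = B.br (g u) (g v)) (p q : Q) :
    g (b p q) = B.br (g p) (g q) := by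
  have leib' : ∀ p q r, b (p * q) r = p * b q r + q * b p r := fun p q r => by
    rw [skew, leib, skew q, skew p]; ring
  have h1 : ∀ u ∈ X, ∀ q, g (b u q) = B.br (g u) (g q) := by
    intro u hu q
    rw [← sub_eq_zero]
    refine hX (g.toLinearMap ∘ₗ b u - B.br (g u) ∘ₗ g.toLinearMap) (fun p q => ?_)
      (fun w hw => ?_) q
    · simp only [LinearMap.sub_apply, LinearMap.comp_apply, AlgHom.toLinearMap_apply,
        leib, map_mul, map_add, B.leibniz]
      ring
    · exact sub_eq_zero.2 (gen u hu w hw)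
  rw [← sub_eq_zero]
  refine hX (g.toLinearMap ∘ₗ b.flip q - B.br.flip (g q) ∘ₗ g.toLinearMap) (fun p p' => ?_)
    (fun w hw => ?_) p
  · simp only [LinearMap.sub_apply, LinearMap.comp_apply, AlgHom.toLinearMap_apply,
      LinearMap.flip_apply, leib', map_mul, map_add, B.leibniz_left]
    ring
  · exact sub_eq_zero.2 (h1 w hw q)

end BiderivationJacobi

namespace FreeLie

variable {R M : Type*} [CommRing R] [AddCommGroup M] [Module R M]

theorem lieToPlus_skew (l m : FreeLie R M) : lieToPlus R M l m = -lieToPlus R M m l :=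
  Subtype.ext (lie_skew _ _).symm

theorem lieToPlus_self (l : FreeLie R M) : lieToPlus R M l l = 0 :=
  Subtype.ext (lie_self _)

end FreeLie

/-! ### The Poisson bracket of the model -/

section Model

/-- The algebra `A ⊗ SL₊V`. -/
abbrev LieModel (k A V : Type*) [CommRing k] [CommRing A] [Algebra k A] [AddCommGroup V]
    [Module k V] := A ⊗[k] SymmetricAlgebra k (FreeLie.plus k V)

variable {k A V : Type*} [CommRing k] [CommRing A] [Algebra k A] [AddCommGroup V] [Module k V]

variable (k V) in
/-- The derivation of `SL₊V` with `l ↦ 1 ⊗ l`. -/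
def deRhamPlus : Derivation k (SymmetricAlgebra k (FreeLie.plus k V))
    (SymmetricAlgebra k (FreeLie.plus k V) ⊗[k] FreeLie.plus k V) :=
  symDer k (TensorProduct.mk k (SymmetricAlgebra k (FreeLie.plus k V)) (FreeLie.plus k V) 1)

variable (k A V) in
/-- The bracket of `LV` with values in `A ⊗ SL₊V`. -/
def lieValue : FreeLie k V →ₗ[k] FreeLie k V →ₗ[k] LieModel k A V :=
  (FreeLie.lieToPlus k V).compr₂
    ((Algebra.TensorProduct.includeRight :
        SymmetricAlgebra k (FreeLie.plus k V) →ₐ[k] LieModel k A V).toLinearMap ∘ₗ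
      SymmetricAlgebra.ι k (FreeLie.plus k V))

theorem lieValue_apply (l m : FreeLie k V) :
    lieValue k A V l m = 1 ⊗ₜ SymmetricAlgebra.ι k _ (FreeLie.lieToPlus k V l m) := rfl

theorem lieValue_skew (l m : FreeLie k V) : lieValue k A V l m = -lieValue k A V m l := by
  rw [lieValue_apply, FreeLie.lieToPlus_skew, map_neg, tmul_neg, ← lieValue_apply]

theorem lieValue_self (l : FreeLie k V) : lieValue k A V l l = 0 := by
  rw [lieValue_apply, FreeLie.lieToPlus_self, map_zero, tmul_zero]

namespace DiffCoord

variable (c : DiffCoord k A V)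

/-- The derivation from `A ⊗ SL₊V` to `A ⊗ SL₊V ⊗ LV`. -/
def lieD : LieModel k A V →ₗ[k] LieModel k A V ⊗[k] FreeLie k V :=
  productD (c.deRham : A →ₗ[k] A ⊗[k] V)
    (deRhamPlus k V : SymmetricAlgebra k (FreeLie.plus k V) →ₗ[k] _) (FreeLie.ι k V)
    (FreeLie.plus k V).subtype

theorem lieD_mul (p q : LieModel k A V) : c.lieD (p * q) = p • c.lieD q + q • c.lieD p :=
  productD_mul _ _ _ _ _ _

/-- The Lie homomorphism `LV → A ⊗ SL₊V` which sends `dxᵢ` to `xᵢ ⊗ 1` and `l ∈ L₊V` to `1 ⊗ l`. -/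
def lieGen : FreeLie k V →ₗ[k] LieModel k A V :=
  (Algebra.TensorProduct.includeLeft : A →ₐ[k] LieModel k A V).toLinearMap ∘ₗ c.primitive ∘ₗ
      FreeLie.proj k V +
    (Algebra.TensorProduct.includeRight : SymmetricAlgebra k (FreeLie.plus k V) →ₐ[k] LieModel k A V).toLinearMap ∘ₗ
      SymmetricAlgebra.ι k _ ∘ₗ FreeLie.plusProj k V

theorem lieGen_apply (l : FreeLie k V) :
    c.lieGen l = c.primitive (FreeLie.proj k _ l) ⊗ₜ 1 +
      1 ⊗ₜ SymmetricAlgebra.ι k _ (FreeLie.plusProj k _ l) := rfl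

@[simp]
theorem lieGen_ι (v : V) : c.lieGen (FreeLie.ι k _ v) = c.primitive v ⊗ₜ 1 := by
  simp [lieGen_apply]

@[simp]
theorem lieGen_coe (l : FreeLie.plus k V) :
    c.lieGen l = 1 ⊗ₜ SymmetricAlgebra.ι k _ l := by
  simp [lieGen_apply, FreeLie.proj_eq_zero l.2]

theorem lieD_tmul_one (a : A) : c.lieD (a ⊗ₜ 1) = tmulMiddle (FreeLie.ι k V) 1 (c.deRham a) := by
  rw [lieD, productD_tmul, Derivation.coeFn_coe, Derivation.coeFn_coe,
    Derivation.map_one_eq_zero, map_zero, add_zero]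

/-- The two summands of $D$ account for the two summands of $LV=V\oplus L_+V$: the differential of a
coordinate is its vector in $V$, and the universal derivation of $S(L_+V)$ returns $l$. -/
theorem lieD_lieGen (l : FreeLie k V) : c.lieD (c.lieGen l) = 1 ⊗ₜ l := by
  have h1 : ∀ v, c.lieD (c.primitive v ⊗ₜ 1) = 1 ⊗ₜ FreeLie.ι k V v := fun v => by
    rw [lieD_tmul_one, deRham_primitive, tmulMiddle_tmul, Algebra.TensorProduct.one_def]
  have h2 : ∀ l : FreeLie.plus k V,
      c.lieD (1 ⊗ₜ SymmetricAlgebra.ι k _ l) = 1 ⊗ₜ (l : FreeLie k V) := fun l => by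
    rw [lieD, productD_tmul, Derivation.coeFn_coe, Derivation.coeFn_coe,
      Derivation.map_one_eq_zero, map_zero, zero_add, deRhamPlus, symDer_ι,
      TensorProduct.mk_apply, tmulLeft_tmul, Algebra.TensorProduct.one_def, Submodule.subtype_apply]
  rw [lieGen_apply, map_add, h1, h2, ← tmul_add, FreeLie.ι_proj_add_plusProj]

/-- The bracket `{p, q} = φ(Dp, Dq)`. -/
def lieBr : LieModel k A V →ₗ[k] LieModel k A V →ₗ[k] LieModel k A V :=
  (extendPairing (lieValue k A V)).compl₁₂ c.lieD c.lieD

theorem lieBr_apply (p q : LieModel k A V) :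
    c.lieBr p q = extendPairing (lieValue k A V) (c.lieD p) (c.lieD q) := rfl

theorem lieBr_self (p : LieModel k A V) : c.lieBr p p = 0 :=
  extendPairing_self _ lieValue_self lieValue_skew _

theorem lieBr_skew (p q : LieModel k A V) : c.lieBr p q = -c.lieBr q p :=
  extendPairing_skew _ lieValue_skew _ _

theorem lieBr_mul_right (p q r : LieModel k A V) :
    c.lieBr p (q * r) = q * c.lieBr p r + r * c.lieBr p q := by
  rw [lieBr_apply, lieD_mul, map_add, extendPairing_smul_right, extendPairing_smul_right]
  rfl

/-- A bracket always lies in $L_+V$, where `lieGen` is $l\mapsto 1\otimes l$; this makes the value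
of $\phi$ equal to `lieGen` of the bracket. -/
theorem lieBr_lieGen (l m : FreeLie k V) :
    c.lieBr (c.lieGen l) (c.lieGen m) = c.lieGen ⁅l, m⁆ := by
  rw [lieBr_apply, lieD_lieGen, lieD_lieGen, extendPairing_tmul, mul_one, one_mul, lieValue_apply,
    ← c.lieGen_coe]
  rfl

/-- A derivation on the model along an algebra homomorphism vanishes if it vanishes on `LV`. -/
theorem lieModel_derivation_eq_zero {P : Type*} [CommRing P] [Algebra k P]
    (g : LieModel k A V →ₐ[k] P) (D : LieModel k A V →ₗ[k] P)
    (hD : ∀ p q, D (p * q) = g p * D q + g q * D p) (h0 : ∀ l, D (c.lieGen l) = 0)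
    (p : LieModel k A V) : D p = 0 := by
  -- On the factor `A` only the coordinate functions are known to be killed; this suffices because
  -- their differentials generate $\Omega^1_A$.
  have h1 : ∀ a : A, D (a ⊗ₜ 1) = 0 := by
    intro a
    refine c.derivation_eq_zero
      (g.comp (Algebra.TensorProduct.includeLeft : A →ₐ[k] LieModel k A V))
      (D ∘ₗ (Algebra.TensorProduct.includeLeft : A →ₐ[k] LieModel k A V).toLinearMap)
      (fun a b => ?_) (fun v => ?_) a
    · rw [LinearMap.comp_apply, AlgHom.toLinearMap_apply, map_mul, hD]
      rfl
    · rw [← h0 (FreeLie.ι k V v), lieGen_ι]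
      rfl
  have h2 : ∀ s : SymmetricAlgebra k (FreeLie.plus k V), D (1 ⊗ₜ s) = 0 := by
    intro s
    induction s using SymmetricAlgebra.induction with
    | algebraMap r =>
      rw [Algebra.algebraMap_eq_smul_one, tmul_smul, map_smul, h1, smul_zero]
    | ι l => rw [← c.lieGen_coe, h0]
    | mul s t hs ht =>
      rw [show (1 : A) ⊗ₜ[k] (s * t) = (1 ⊗ₜ s : LieModel k A V) * (1 ⊗ₜ t) by simp, hD, hs, ht]
      simp
    | add s t hs ht => rw [tmul_add, map_add, hs, ht, add_zero]
  induction p using TensorProduct.induction_on with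
  | zero => simp
  | add p q hp hq => rw [map_add, hp, hq, add_zero]
  | tmul a s =>
    rw [show a ⊗ₜ[k] s = (a ⊗ₜ 1 : LieModel k A V) * (1 ⊗ₜ s) by simp, hD, h1, h2]
    simp

/-- On the image of $LV$ this is the Jacobi identity of the free Lie algebra. -/
theorem lieBr_jacobi (p q r : LieModel k A V) :
    c.lieBr p (c.lieBr q r) = c.lieBr (c.lieBr p q) r + c.lieBr q (c.lieBr p r) := by
  refine jacobi_of_generators c.lieBr c.lieBr_skew c.lieBr_mul_right (Set.range c.lieGen)
    (fun D hD h0 => c.lieModel_derivation_eq_zero (AlgHom.id k _) D hD fun l => h0 _ ⟨l, rfl⟩) ?_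
    p q r
  rintro _ ⟨l, rfl⟩ _ ⟨m, rfl⟩ _ ⟨n, rfl⟩
  simp only [lieBr_lieGen]
  rw [← map_add, leibniz_lie]

/-- The Poisson structure of the model. -/
def liePoisson : PoissonBracket k (LieModel k A V) where
  br := c.lieBr
  self := c.lieBr_self
  jacobi := c.lieBr_jacobi
  leibniz a b c := by rw [lieBr_mul_right]; ring

theorem lieModel_algHom_ext {P : Type*} [CommRing P] [Algebra k P] {f g : LieModel k A V →ₐ[k] P}
    (h1 : ∀ a : A, f (a ⊗ₜ 1) = g (a ⊗ₜ 1)) (h2 : ∀ l, f (c.lieGen l) = g (c.lieGen l)) :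
    f = g := by
  apply Algebra.TensorProduct.ext
  · ext a; exact h1 a
  · apply SymmetricAlgebra.algHom_ext
    ext l
    simpa using h2 l

/-- A Poisson homomorphism is forced on the coordinates by `f`, hence on all of $LV$ by freeness,
and $A$ and $LV$ together generate the model. -/
theorem isPoissonEnvelope_liePoisson (c : DiffCoord k A V) : IsPoissonEnvelope.{w} c.liePoisson
    (Algebra.TensorProduct.includeLeft : A →ₐ[k] LieModel k A V) := by
  intro P _ _ B f
  let ψ : FreeLie k V →ₗ[k] P := FreeLie.liftPoisson B (f.toLinearMap ∘ₗ c.primitive)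
  let g : LieModel k A V →ₐ[k] P := Algebra.TensorProduct.productMap f
    (SymmetricAlgebra.lift (ψ ∘ₗ (FreeLie.plus k V).subtype))
  have hg1 : ∀ a : A, g (a ⊗ₜ 1) = f a := fun a => by simp [g]
  -- By construction `g` is `ψ` on $L_+V$; on $V$ the two agree because `ψ` was defined through the
  -- coordinate functions.
  have hg2 : ∀ l, g (c.lieGen l) = ψ l := by
    intro l
    conv_rhs => rw [← FreeLie.ι_proj_add_plusProj l]
    simp [g, lieGen_apply, ψ]
  refine ⟨g, ⟨?_, ?_⟩, ?_⟩
  · refine map_bracket_of_generators c.lieBr c.lieBr_skew c.lieBr_mul_right B g (Set.range c.lieGen)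
      (fun D hD h0 => c.lieModel_derivation_eq_zero g D hD fun l => h0 _ ⟨l, rfl⟩) ?_
    rintro _ ⟨l, rfl⟩ _ ⟨m, rfl⟩
    rw [lieBr_lieGen, hg2, hg2, hg2, FreeLie.liftPoisson_lie]
  · ext a; exact hg1 a
  · rintro g' ⟨h1, h2⟩
    have h2' : ∀ a : A, g' (a ⊗ₜ 1) = f a := fun a => DFunLike.congr_fun h2 a
    refine c.lieModel_algHom_ext (fun a => by rw [h2', hg1]) fun l => ?_
    have : g'.toLinearMap ∘ₗ c.lieGen = ψ := by
      refine FreeLie.linearMap_ext_of_lie B (fun l m => ?_) (FreeLie.liftPoisson_lie B _) fun v => ?_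
      · rw [LinearMap.comp_apply, ← lieBr_lieGen]
        exact h1 _ _
      · simp only [LinearMap.comp_apply, AlgHom.toLinearMap_apply, lieGen_ι, h2', ψ,
          FreeLie.liftPoisson_ι]
    exact (DFunLike.congr_fun this l).trans (hg2 l).symm

end DiffCoord

end Model

/-- Two Poisson envelopes are isomorphic. -/
theorem IsPoissonEnvelope.exists_equiv {k : Type*} {A : Type*} {Q : Type u} {Q' : Type v} [CommRing k]
    [CommRing A] [Algebra k A] [CommRing Q] [Algebra k Q] [CommRing Q'] [Algebra k Q']
    {B : PoissonBracket k Q} {i : A →ₐ[k] Q} {B' : PoissonBracket k Q'} {i' : A →ₐ[k] Q'}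
    (h1 : IsPoissonEnvelope.{u} B i) (h2 : IsPoissonEnvelope.{v} B i)
    (h1' : IsPoissonEnvelope.{u} B' i') (h2' : IsPoissonEnvelope.{v} B' i') :
    ∃ e : Q ≃ₐ[k] Q', (∀ p q, e (B.br p q) = B'.br (e p) (e q)) ∧ ∀ a, e (i a) = i' a := by
  -- Each property is quantified over targets in one universe, so the maps between `Q` and `Q'` and
  -- the uniqueness of the identities need both universes for both envelopes.
  obtain ⟨f, ⟨hf, hfi⟩, -⟩ := h2 Q' B' i'
  obtain ⟨g, ⟨hg, hgi⟩, -⟩ := h1' Q B i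
  have hgf : g.comp f = AlgHom.id k Q :=
    (h1 Q B i).unique ⟨fun p q => by rw [AlgHom.comp_apply, hf, hg]; rfl,
      by rw [AlgHom.comp_assoc, hfi, hgi]⟩ ⟨fun _ _ => rfl, AlgHom.id_comp i⟩
  have hfg : f.comp g = AlgHom.id k Q' :=
    (h2' Q' B' i').unique ⟨fun p q => by rw [AlgHom.comp_apply, hg, hf]; rfl,
      by rw [AlgHom.comp_assoc, hgi, hfi]⟩ ⟨fun _ _ => rfl, AlgHom.id_comp i'⟩
  exact ⟨AlgEquiv.ofAlgHom f g hfg hgf, hf, fun a => DFunLike.congr_fun hfi a⟩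

/-! ### The grading of the model -/

section BaseChangeGrade

variable {k A S : Type*} [CommRing k] [CommRing A] [Algebra k A] [CommRing S] [Algebra k S]

instance Submodule.baseChange.gradedMonoid (𝒮 : ℕ → Submodule k S) [SetLike.GradedMonoid 𝒮] :
    SetLike.GradedMonoid fun n => (𝒮 n).baseChange A where
  one_mem := Submodule.tmul_mem_baseChange_of_mem 1 SetLike.GradedOne.one_mem
  mul_mem := by
    intro i j p q hp hq
    rw [Submodule.baseChange_eq_span] at hp hq
    induction hp using Submodule.span_induction with
    | mem p hp =>
      obtain ⟨s, hs, rfl⟩ := hp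
      induction hq using Submodule.span_induction with
      | mem q hq =>
        obtain ⟨t, ht, rfl⟩ := hq
        rw [mk_apply, mk_apply, Algebra.TensorProduct.tmul_mul_tmul]
        exact Submodule.tmul_mem_baseChange_of_mem _ (SetLike.GradedMul.mul_mem hs ht)
      | zero => rw [mul_zero]; exact zero_mem _
      | add x y _ _ hx hy => rw [mul_add]; exact add_mem hx hy
      | smul r x _ hx => rw [mul_smul_comm]; exact Submodule.smul_mem _ r hx
    | zero => rw [zero_mul]; exact zero_mem _
    | add x y _ _ hx hy => rw [add_mul]; exact add_mem hx hy
    | smul r x _ hx => rw [smul_mul_assoc]; exact Submodule.smul_mem _ r hx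

/-- Submodules on which an endomorphism acts by the powers of a scalar of infinite order are
independent. -/
theorem isInternal_of_pow_smul {k M : Type*} [Field k] [CharZero k] [AddCommGroup M] [Module k M]
    (ℳ : ℕ → Submodule k M) (τ : M →ₗ[k] M) (hτ : ∀ n, ∀ m ∈ ℳ n, τ m = (2 : k) ^ n • m)
    (htop : ⨆ n, ℳ n = ⊤) : DirectSum.IsInternal ℳ := by
  rw [DirectSum.isInternal_submodule_iff_iSupIndep_and_iSup_eq_top]
  refine ⟨?_, htop⟩
  -- Characteristic zero makes the eigenvalues $2^n$ distinct.
  have hinj : Function.Injective fun n : ℕ => (2 : k) ^ n := by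
    intro m n hmn
    have : ((2 ^ m : ℕ) : k) = ((2 ^ n : ℕ) : k) := by push_cast; exact hmn
    exact Nat.pow_right_injective le_rfl (Nat.cast_injective this)
  refine ((Module.End.eigenspaces_iSupIndep τ).comp hinj).mono fun n m hm => ?_
  exact Module.End.mem_eigenspace_iff.2 (hτ n m hm)

/-- Being an internal direct sum concerns the underlying additive groups only. -/
theorem isInternal_restrictScalars_iff {k A M : Type*} [CommRing k] [CommRing A] [Algebra k A]
    [AddCommGroup M] [Module k M] [Module A M] [IsScalarTower k A M] (ℳ : ℕ → Submodule A M) :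
    DirectSum.IsInternal (fun n => (ℳ n).restrictScalars k) ↔ DirectSum.IsInternal ℳ := Iff.rfl

theorem isInternal_baseChange_symGrade {k A L : Type*} [Field k] [CharZero k] [CommRing A]
    [Algebra k A] [AddCommGroup L] [Module k L] (ℒ : ℕ → Submodule k L) (hℒ : ⨆ n, ℒ n = ⊤)
    (τ : L →ₗ[k] L) (hτ : ∀ n, ∀ l ∈ ℒ n, τ l = (2 : k) ^ n • l) :
    DirectSum.IsInternal fun n => (symGrade k ℒ n).baseChange A := by
  -- Independence of eigenspaces is applied over the field `k`, to the endomorphism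
  -- $\mathrm{id}_A\otimes S(\tau)$.
  rw [← isInternal_restrictScalars_iff (k := k)]
  let T := (SymmetricAlgebra.lift (SymmetricAlgebra.ι k L ∘ₗ τ)).toLinearMap
  refine isInternal_of_pow_smul _ (T.lTensor A) (fun n p hp => ?_) ?_
  · rw [Submodule.restrictScalars_mem, Submodule.baseChange_eq_span] at hp
    refine Submodule.span_induction (fun p hp => ?_) (by rw [map_zero, smul_zero])
      (fun p q _ _ hp hq => by rw [map_add, smul_add, hp, hq]) (fun a p _ hp => ?_) hp
    · obtain ⟨s, hs, rfl⟩ := hp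
      rw [mk_apply, LinearMap.lTensor_tmul, show T s = _ from lift_eq_pow_smul ℒ 2 τ hτ hs,
        tmul_smul]
    · have : (T.lTensor A) (a • p) = a • (T.lTensor A) p :=
        map_smul (AlgebraTensorModule.map (LinearMap.id : A →ₗ[A] A) T) a p
      rw [this, hp, smul_comm]
  · rw [eq_top_iff]
    rintro p -
    induction p with
    | zero => exact zero_mem _
    | add p q hp hq => exact add_mem hp hq
    | tmul a s =>
      have : (⨆ n, symGrade k ℒ n) ≤ (⨆ n, ((symGrade k ℒ n).baseChange A).restrictScalars k).comap
          (TensorProduct.mk k A _ a) :=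
        iSup_le fun n s hs => le_iSup
          (fun n => ((symGrade k ℒ n).baseChange A).restrictScalars k) n
          (Submodule.tmul_mem_baseChange_of_mem a hs)
      rw [iSup_symGrade ℒ hℒ] at this
      exact this Submodule.mem_top

end BaseChangeGrade

namespace DiffCoord

section Grade

variable {k A V : Type*} [CommRing k] [CommRing A] [Algebra k A] [AddCommGroup V] [Module k V]
variable (c : DiffCoord k A V)

variable (k A V) in
/-- The homogeneous parts of the model. -/
abbrev lieGrade (n : ℕ) : Submodule A (LieModel k A V) :=
  (symGrade k (FreeLie.plusGrade k V) n).baseChange A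

theorem smul_eq_tmul_one_mul (a : A) (q : LieModel k A V) : a • q = (a ⊗ₜ 1) * q :=
  Algebra.smul_def a q

theorem tmul_one_mem (a : A) : a ⊗ₜ 1 ∈ lieGrade k A V 0 :=
  Submodule.tmul_mem_baseChange_of_mem a SetLike.GradedOne.one_mem

theorem lieGrade_smul_mem {n : ℕ} (r : k) {q : LieModel k A V} (hq : q ∈ lieGrade k A V n) :
    r • q ∈ lieGrade k A V n := by
  rw [← algebraMap_smul A r q]
  exact Submodule.smul_mem _ _ hq

theorem lieGen_mem {n : ℕ} {l : FreeLie k V} (hl : l ∈ FreeLie.grade k V n) :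
    c.lieGen l ∈ lieGrade k A V n := by
  rw [lieGen_apply]
  refine add_mem ?_ (Submodule.tmul_mem_baseChange_of_mem _
    (ι_mem_symGrade _ (FreeLie.plusProj_mem_plusGrade hl)))
  cases n with
  | zero => exact tmul_one_mem _
  | succ n =>
    rw [FreeLie.proj_eq_zero (FreeLie.grade_succ_le_plus n hl), map_zero, zero_tmul]
    exact zero_mem _

/-- The bracket with `a ⊗ 1` depends only on $da$, and $A$-linearly so; as $da$ is a combination of
differentials of coordinate functions, these suffice. -/
theorem lieBr_tmul_one_mem_of (n : ℕ) (q : LieModel k A V)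
    (hq : ∀ v, c.lieBr (c.primitive v ⊗ₜ 1) q ∈ lieGrade k A V n) (a : A) :
    c.lieBr (a ⊗ₜ 1) q ∈ lieGrade k A V n := by
  rw [lieBr_apply, lieD_tmul_one]
  induction c.deRham a with
  | zero => rw [map_zero, map_zero]; exact zero_mem _
  | add t t' ht ht' => rw [map_add, map_add, LinearMap.add_apply]; exact add_mem ht ht'
  | tmul a v =>
    have h1 := Submodule.smul_mem _ a (hq v)
    rw [lieBr_apply, ← lieGen_ι, lieD_lieGen] at h1
    convert h1 using 1
    -- Skew symmetry is used on both sides to move the scalar into the second argument, where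
    -- linearity is available.
    rw [tmulMiddle_tmul, extendPairing_skew _ lieValue_skew,
      extendPairing_skew _ lieValue_skew (1 ⊗ₜ _), smul_neg,
      show (a ⊗ₜ[k] (1 : SymmetricAlgebra k (FreeLie.plus k V))) ⊗ₜ[k] FreeLie.ι k V v =
        (a ⊗ₜ[k] (1 : SymmetricAlgebra k (FreeLie.plus k V))) •
          ((1 : LieModel k A V) ⊗ₜ[k] FreeLie.ι k V v) by
        rw [TensorProduct.smul_tmul', smul_eq_mul, mul_one], extendPairing_smul_right,
      smul_eq_tmul_one_mul]

/-- Bracketing with an element of `A` raises the degree by one. -/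
theorem lieBr_tmul_one_mem {n : ℕ} {q : LieModel k A V} (hq : q ∈ lieGrade k A V n) (a : A) :
    c.lieBr (a ⊗ₜ 1) q ∈ lieGrade k A V (n + 1) := by
  refine c.lieBr_tmul_one_mem_of _ _ (fun v => ?_) a
  -- Reducing the second argument to coordinates as well leaves brackets of two generators, which
  -- have degree one.
  have h0 : ∀ a : A, c.lieBr (c.primitive v ⊗ₜ 1) (a ⊗ₜ 1) ∈ lieGrade k A V 1 := fun a => by
    rw [lieBr_skew]
    refine neg_mem (c.lieBr_tmul_one_mem_of _ _ (fun w => ?_) a)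
    rw [← lieGen_ι, ← lieGen_ι, lieBr_lieGen]
    exact c.lieGen_mem (Submodule.subset_span ⟨w, _, ⟨v, rfl⟩, rfl⟩)
  have h1 : ∀ n, ∀ s ∈ symGrade k (FreeLie.plusGrade k V) n,
      c.lieBr (c.primitive v ⊗ₜ 1) (1 ⊗ₜ s) ∈ lieGrade k A V (n + 1) := by
    intro n s hs
    rw [symGrade] at hs
    induction hs using Submodule.span_induction with
    | mem s hs =>
      obtain ⟨m, hm, rfl, rfl⟩ := hs
      induction m using Multiset.induction_on with
      | empty => simpa using h0 1
      | cons p m ih =>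
        have hm' := fun q hq => hm q (Multiset.mem_cons_of_mem hq)
        have hp := hm p (Multiset.mem_cons_self p m)
        simp only [Multiset.map_cons, Multiset.prod_cons, Multiset.sum_cons]
        rw [show ∀ s t : SymmetricAlgebra k (FreeLie.plus k V),
          (1 : A) ⊗ₜ[k] (s * t) = (1 ⊗ₜ s : LieModel k A V) * (1 ⊗ₜ t) by simp, lieBr_mul_right]
        refine add_mem ?_ ?_
        · rw [add_assoc]
          exact SetLike.GradedMul.mul_mem (A := lieGrade k A V)
            (Submodule.tmul_mem_baseChange_of_mem _ (ι_mem_symGrade _ hp)) (ih hm')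
        · rw [add_assoc, add_comm, add_assoc, add_comm 1]
          refine SetLike.GradedMul.mul_mem (A := lieGrade k A V)
            (Submodule.tmul_mem_baseChange_of_mem _ (Submodule.subset_span ⟨m, hm', rfl, rfl⟩)) ?_
          rw [← c.lieGen_coe, ← lieGen_ι, lieBr_lieGen]
          exact c.lieGen_mem (Submodule.subset_span ⟨v, _, hp, rfl⟩)
    | zero => rw [tmul_zero, map_zero]; exact zero_mem _
    | add s t _ _ hs ht => rw [tmul_add, map_add]; exact add_mem hs ht
    | smul r s _ hs => rw [tmul_smul, map_smul]; exact lieGrade_smul_mem r hs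
  rw [lieGrade, Submodule.baseChange_eq_span] at hq
  induction hq using Submodule.span_induction with
  | mem q hq => obtain ⟨s, hs, rfl⟩ := hq; exact h1 n s hs
  | zero => rw [map_zero]; exact zero_mem _
  | add s t _ _ hs ht => rw [map_add]; exact add_mem hs ht
  | smul a q hq ih =>
    rw [← Submodule.baseChange_eq_span] at hq
    rw [smul_eq_tmul_one_mul, lieBr_mul_right, ← smul_eq_tmul_one_mul]
    refine add_mem (Submodule.smul_mem _ a ih) ?_
    exact SetLike.GradedMul.mul_mem (A := lieGrade k A V) hq (h0 a)

end Grade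

/-! ### Comparison of the envelope with the model -/

section Equiv

variable {k : Type u} {A : Type v} {V : Type w} [CommRing k] [CommRing A] [Algebra k A]
  [AddCommGroup V] [Module k V] (c : DiffCoord k A V)

/-- The Poisson envelope is isomorphic to the model. -/
theorem exists_equiv : ∃ e : PoissonEnvelope k A ≃ₐ[A] LieModel k A V,
    (∀ p q, e ((PoissonEnvelope.poisson k A).br p q) = c.liePoisson.br (e p) (e q)) ∧
    ∀ n : ℕ, (PoissonEnvelope.grade k A n).map e.toLinearMap = lieGrade k A V n := by
  obtain ⟨e, he, hi⟩ := IsPoissonEnvelope.exists_equiv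
    (PoissonEnvelope.isPoissonEnvelope (k := k) (A := A)) PoissonEnvelope.isPoissonEnvelope
    c.isPoissonEnvelope_liePoisson c.isPoissonEnvelope_liePoisson
  -- Compatibility with the two maps from `A` is exactly `A`-linearity.
  refine ⟨AlgEquiv.ofRingEquiv (f := e.toRingEquiv) hi, he, fun n => le_antisymm ?_ ?_⟩
  · rintro _ ⟨_, ⟨s, hs, rfl⟩, rfl⟩
    refine symGrade_le (FreeLie.grade k A)
      ((e : PoissonEnvelope k A →ₐ[k] LieModel k A V).comp (PoissonEnvelope.mk k A))
      (lieGrade k A V) (fun n r b hb => lieGrade_smul_mem r hb) (fun n l hl => ?_) hs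
    change e (PoissonEnvelope.ofLie k A l) ∈ _
    -- An element of $L_nA$ is a sum of `n`-fold brackets by elements of $A$, each of which raises
    -- the degree by one.
    induction n generalizing l with
    | zero =>
      obtain ⟨a, rfl⟩ := hl
      rw [PoissonEnvelope.ofLie_ι, hi]
      exact tmul_one_mem a
    | succ n ih =>
      induction hl using Submodule.span_induction with
      | mem l hl =>
        obtain ⟨a, l, hl, rfl⟩ := hl
        rw [PoissonEnvelope.ofLie_lie, PoissonEnvelope.ofLie_ι, he, hi]
        exact c.lieBr_tmul_one_mem (ih l hl) a
      | zero => rw [map_zero, map_zero]; exact zero_mem _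
      | add l m _ _ hl hm => rw [map_add, map_add]; exact add_mem hl hm
      | smul r l _ hl => rw [map_smul, map_smul]; exact lieGrade_smul_mem r hl
  -- For the reverse inclusion: the image of $LV$ in the model is hit by elements of $LA$, through
  -- the coordinate functions $V\to A$. Both sides are Lie homomorphisms on $LV$, so only $V$ has to
  -- be compared.
  · have hgen : (e : PoissonEnvelope k A →ₐ[k] LieModel k A V).toLinearMap ∘ₗ
        PoissonEnvelope.ofLie k A ∘ₗ (FreeLie.map c.primitive).toLinearMap = c.lieGen := by
      refine FreeLie.linearMap_ext_of_lie c.liePoisson (fun l m => ?_)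
        (fun l m => (c.lieBr_lieGen l m).symm) fun v => ?_
      · change e (PoissonEnvelope.ofLie k A (FreeLie.map c.primitive ⁅l, m⁆)) = _
        rw [LieHom.map_lie, PoissonEnvelope.ofLie_lie, he]
        rfl
      · change e (PoissonEnvelope.ofLie k A (FreeLie.map c.primitive (FreeLie.ι k V v))) = _
        rw [FreeLie.map_ι, PoissonEnvelope.ofLie_ι, hi, lieGen_ι]
        rfl
    have h1 : ∀ n, ∀ s ∈ symGrade k (FreeLie.plusGrade k V) n,
        e.symm (1 ⊗ₜ s) ∈ PoissonEnvelope.grade k A n := by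
      intro n s hs
      refine symGrade_le (FreeLie.plusGrade k V)
        ((e.symm : LieModel k A V →ₐ[k] PoissonEnvelope k A).comp
          Algebra.TensorProduct.includeRight)
        (PoissonEnvelope.grade k A) (fun n r b hb => ?_) (fun n l hl => ?_) hs
      · rw [← algebraMap_smul A r b]
        exact Submodule.smul_mem _ _ hb
      · change e.symm (1 ⊗ₜ SymmetricAlgebra.ι k _ l) ∈ _
        rw [← c.lieGen_coe, ← hgen]
        change e.symm (e (PoissonEnvelope.ofLie k A (FreeLie.map c.primitive l))) ∈ _
        rw [AlgEquiv.symm_apply_apply]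
        exact PoissonEnvelope.ofLie_mem_grade (FreeLie.map_mem_grade _ hl)
    rw [lieGrade, Submodule.baseChange_eq_span, Submodule.span_le]
    rintro _ ⟨s, hs, rfl⟩
    exact ⟨_, h1 n s hs, e.apply_symm_apply _⟩

end Equiv

end DiffCoord

/-! ### Base change of free Lie algebras -/

section BaseChange

variable {k A V M : Type*} [CommRing k] [CommRing A] [Algebra k A] [AddCommGroup V] [Module k V]
  [AddCommGroup M] [Module A M]

theorem Submodule.map_mem_baseChange {L L' : Type*} [AddCommGroup L] [Module k L] [AddCommGroup L']
    [Module k L'] (f : L →ₗ[k] L') {S : Submodule k L} {S' : Submodule k L'}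
    (h : ∀ l ∈ S, f l ∈ S') {t : A ⊗[k] L} (ht : t ∈ S.baseChange A) :
    f.baseChange A t ∈ S'.baseChange A := by
  rw [Submodule.baseChange_eq_span] at ht
  induction ht using Submodule.span_induction with
  | mem t ht =>
    obtain ⟨l, hl, rfl⟩ := ht
    exact Submodule.tmul_mem_baseChange_of_mem 1 (h l hl)
  | zero => rw [map_zero]; exact zero_mem _
  | add t t' _ _ ht ht' => rw [map_add]; exact add_mem ht ht'
  | smul a t _ ht => rw [map_smul]; exact Submodule.smul_mem _ a ht

theorem lie_mem_baseChange {L : Type*} [LieRing L] [LieAlgebra k L] {S T U : Submodule k L}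
    (h : ∀ x ∈ S, ∀ y ∈ T, ⁅x, y⁆ ∈ U) {s t : A ⊗[k] L} (hs : s ∈ S.baseChange A)
    (ht : t ∈ T.baseChange A) : ⁅s, t⁆ ∈ U.baseChange A := by
  rw [Submodule.baseChange_eq_span] at hs ht
  induction hs using Submodule.span_induction with
  | mem s hs =>
    obtain ⟨x, hx, rfl⟩ := hs
    induction ht using Submodule.span_induction with
    | mem t ht =>
      obtain ⟨y, hy, rfl⟩ := ht
      rw [mk_apply, mk_apply, LieAlgebra.ExtendScalars.bracket_tmul]
      exact Submodule.tmul_mem_baseChange_of_mem _ (h x hx y hy)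
    | zero => rw [lie_zero]; exact zero_mem _
    | add t t' _ _ ht ht' => rw [lie_add]; exact add_mem ht ht'
    | smul a t _ ht => rw [lie_smul]; exact Submodule.smul_mem _ a ht
  | zero => rw [zero_lie]; exact zero_mem _
  | add s s' _ _ hs hs' => rw [add_lie]; exact add_mem hs hs'
  | smul a s _ hs => rw [smul_lie]; exact Submodule.smul_mem _ a hs

namespace FreeLie

/-- The free Lie algebra commutes with base change. -/
theorem exists_baseChange_equiv (ε : A ⊗[k] V ≃ₗ[A] M) :
    ∃ E : A ⊗[k] FreeLie k V ≃ₗ[A] FreeLie A M,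
      (∀ n, ∀ l ∈ grade k V n, E (1 ⊗ₜ l) ∈ grade A M n) ∧
      ∀ n, ∀ l ∈ grade A M n, E.symm l ∈ (grade k V n).baseChange A := by
  -- Restriction of scalars makes the target a Lie algebra over `k`, so that the universal property
  -- of $LV$ over `k` applies to it.
  let _ : Module k (FreeLie A M) := Module.compHom _ (algebraMap k A)
  have : IsScalarTower k A (FreeLie A M) := IsScalarTower.of_algebraMap_smul fun _ _ => rfl
  let _ : LieAlgebra k (FreeLie A M) :=
    { lie_smul := fun r x y => lie_smul (algebraMap k A r) x y }
  let _ : Module k M := Module.compHom _ (algebraMap k A)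
  have : IsScalarTower k A M := IsScalarTower.of_algebraMap_smul fun _ _ => rfl
  let j : V →ₗ[k] FreeLie A M :=
    (ι A M).restrictScalars k ∘ₗ ε.toLinearMap.restrictScalars k ∘ₗ TensorProduct.mk k A V 1
  have hj : ∀ v, j v = ι A M (ε (1 ⊗ₜ v)) := fun v => rfl
  let α : A ⊗[k] FreeLie k V →ₗ[A] FreeLie A M :=
    LinearMap.liftBaseChange A (lift j : FreeLie k V →ₗ⁅k⁆ FreeLie A M).toLinearMap
  have hα : ∀ a l, α (a ⊗ₜ l) = a • lift j l := fun a l => LinearMap.liftBaseChange_tmul _ _ _ _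
  have hα_lie : ∀ s t, α ⁅s, t⁆ = ⁅α s, α t⁆ := by
    intro s t
    induction s with
    | zero => rw [zero_lie, map_zero, zero_lie]
    | add s s' hs hs' => rw [add_lie, map_add, map_add, add_lie, hs, hs']
    | tmul a l =>
      induction t with
      | zero => rw [lie_zero, map_zero, lie_zero]
      | add t t' ht ht' => rw [lie_add, map_add, map_add, lie_add, ht, ht']
      | tmul b m =>
        rw [LieAlgebra.ExtendScalars.bracket_tmul, hα, hα, hα, LieHom.map_lie, smul_lie, lie_smul,
          smul_smul]
  let β : FreeLie A M →ₗ⁅A⁆ A ⊗[k] FreeLie k V := lift ((ι k V).baseChange A ∘ₗ ε.symm.toLinearMap)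
  have hβ : ∀ m, β (ι A M m) = (ι k V).baseChange A (ε.symm m) := fun m => lift_ι _ m
  have hαι : ∀ t : A ⊗[k] V, α ((ι k V).baseChange A t) = ι A M (ε t) := by
    intro t
    induction t with
    | zero => simp only [map_zero]
    | add t t' ht ht' => simp only [map_add, ht, ht']
    | tmul a v =>
      rw [LinearMap.baseChange_tmul, hα, lift_ι, hj, ← map_smul, ← map_smul, smul_tmul',
        smul_eq_mul, mul_one]
  -- As a Lie homomorphism over `A`, the composite with `β` need only be compared with the identity
  -- on `M`.
  let α' : A ⊗[k] FreeLie k V →ₗ⁅A⁆ FreeLie A M := { α with map_lie' := fun {s t} => hα_lie s t }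
  have hαβ : ∀ l, α (β l) = l := by
    have : α'.comp β = LieHom.id := lieHom_ext fun m => by
      change α (β (ι A M m)) = ι A M m
      rw [hβ, hαι, LinearEquiv.apply_symm_apply]
    exact fun l => DFunLike.congr_fun this l
  have hβα' : ∀ l, β (lift j l) = 1 ⊗ₜ l := by
    have : LinearMap.eqLocus (β.toLinearMap.restrictScalars k ∘ₗ
        (lift j : FreeLie k V →ₗ⁅k⁆ FreeLie A M).toLinearMap) (TensorProduct.mk k A _ 1) = ⊤ := by
      refine eq_top_of_lie_mem _ (fun v => ?_) fun v l hl => ?_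
      · change β (lift j (ι k V v)) = 1 ⊗ₜ ι k V v
        rw [lift_ι, hj, hβ, LinearEquiv.symm_apply_apply, LinearMap.baseChange_tmul]
      · change β (lift j l) = 1 ⊗ₜ l at hl
        change β (lift j ⁅ι k V v, l⁆) = 1 ⊗ₜ ⁅ι k V v, l⁆
        rw [LieHom.map_lie, LieHom.map_lie, hl, lift_ι, hj, hβ, LinearEquiv.symm_apply_apply,
          LinearMap.baseChange_tmul, LieAlgebra.ExtendScalars.bracket_tmul, one_mul]
    intro l
    have hl : l ∈ LinearMap.eqLocus (β.toLinearMap.restrictScalars k ∘ₗ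
      (lift j : FreeLie k V →ₗ⁅k⁆ FreeLie A M).toLinearMap) (TensorProduct.mk k A _ 1) := by
        rw [this]; trivial
    exact hl
  have hβα : ∀ t, β (α t) = t := by
    intro t
    induction t with
    | zero => rw [map_zero, map_zero]
    | add t t' ht ht' => rw [map_add, map_add, ht, ht']
    | tmul a l => rw [hα, map_smul, hβα', smul_tmul', smul_eq_mul, mul_one]
  let E : A ⊗[k] FreeLie k V ≃ₗ[A] FreeLie A M :=
    LinearEquiv.ofLinearMap α β.toLinearMap (LinearMap.ext hαβ) (LinearMap.ext hβα)
  refine ⟨E, fun n l hl => ?_, fun n l hl => ?_⟩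
  · change α (1 ⊗ₜ l) ∈ _
    rw [hα, one_smul]
    induction n generalizing l with
    | zero => obtain ⟨v, rfl⟩ := hl; rw [lift_ι, hj]; exact ⟨_, rfl⟩
    | succ n ih =>
      induction hl using Submodule.span_induction with
      | mem l hl =>
        obtain ⟨v, l, hl, rfl⟩ := hl
        rw [LieHom.map_lie, lift_ι, hj]
        exact Submodule.subset_span ⟨_, _, ih l hl, rfl⟩
      | zero => rw [map_zero]; exact zero_mem _
      | add x y _ _ hx hy => rw [map_add]; exact add_mem hx hy
      | smul r x _ hx =>
        rw [map_smul, ← algebraMap_smul A]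
        exact Submodule.smul_mem _ _ hx
  · change β l ∈ _
    have h0 : ∀ m, β (ι A M m) ∈ (grade k V 0).baseChange A := by
      intro m
      rw [hβ]
      have : ε.symm m ∈ (⊤ : Submodule k V).baseChange A := by
        rw [Submodule.baseChange_top]; trivial
      exact Submodule.map_mem_baseChange (S' := grade k V 0) (ι k V) (fun v _ => ⟨v, rfl⟩) this
    induction n generalizing l with
    | zero => obtain ⟨m, rfl⟩ := hl; exact h0 m
    | succ n ih =>
      induction hl using Submodule.span_induction with
      | mem l hl =>
        obtain ⟨m, l, hl, rfl⟩ := hl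
        rw [LieHom.map_lie]
        refine lie_mem_baseChange ?_ (h0 m) (ih l hl)
        rintro _ ⟨v, rfl⟩ y hy
        exact Submodule.subset_span ⟨v, y, hy, rfl⟩
      | zero => rw [map_zero]; exact zero_mem _
      | add x y _ _ hx hy => rw [map_add]; exact add_mem hx hy
      | smul r x _ hx => rw [map_smul]; exact Submodule.smul_mem _ _ hx

/-- The part of positive degree of the free Lie algebra commutes with base change. -/
theorem exists_plus_baseChange_equiv (ε : A ⊗[k] V ≃ₗ[A] M) :
    ∃ E : A ⊗[k] plus k V ≃ₗ[A] plus A M,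
      (∀ n, ∀ l ∈ plusGrade k V n, E (1 ⊗ₜ l) ∈ plusGrade A M n) ∧
      ∀ n, ∀ l ∈ plusGrade A M n, E.symm l ∈ (plusGrade k V n).baseChange A := by
  obtain ⟨E, hE, hE'⟩ := exists_baseChange_equiv ε
  -- Both maps are corrected by the projections onto positive degree, so no separate proof is needed
  -- that `E` restricts to $L_+$.
  let α : A ⊗[k] plus k V →ₗ[A] plus A M :=
    plusProj A M ∘ₗ E.toLinearMap ∘ₗ (plus k V).subtype.baseChange A
  let β : plus A M →ₗ[A] A ⊗[k] plus k V :=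
    (plusProj k V).baseChange A ∘ₗ E.symm.toLinearMap ∘ₗ (plus A M).subtype
  have hgrade : ∀ n, ∀ t ∈ (plusGrade k V n).baseChange A, α t ∈ plusGrade A M n := by
    intro n t ht
    rw [Submodule.baseChange_eq_span] at ht
    induction ht using Submodule.span_induction with
    | mem t ht =>
      obtain ⟨l, hl, rfl⟩ := ht
      exact plusProj_mem_plusGrade (hE n l hl)
    | zero => rw [map_zero]; exact zero_mem _
    | add t t' _ _ ht ht' => rw [map_add]; exact add_mem ht ht'
    | smul a t _ ht => rw [map_smul]; exact Submodule.smul_mem _ a ht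
  have hβgrade : ∀ n, ∀ l ∈ plusGrade A M n, β l ∈ (plusGrade k V n).baseChange A :=
    fun n l hl => Submodule.map_mem_baseChange (plusProj k V)
      (fun l hl => plusProj_mem_plusGrade hl) (hE' n l hl)
  -- both compositions are computed on homogeneous elements
  have hcoe : ∀ n, ∀ l ∈ plusGrade k V n, (α (1 ⊗ₜ l) : FreeLie A M) = E (1 ⊗ₜ (l : FreeLie k V)) := by
    intro n l hl
    have h := hE n l hl
    cases n with
    | zero =>
      rw [plusGrade_zero, Submodule.mem_bot] at hl
      subst hl
      simp only [tmul_zero, map_zero, ZeroMemClass.coe_zero]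
    | succ n =>
      exact congrArg Subtype.val (plusProj_coe ⟨_, grade_succ_le_plus n h⟩)
  have hβα : β ∘ₗ α = LinearMap.id := by
    refine AlgebraTensorModule.curry_injective (LinearMap.ext_ring (LinearMap.ext fun l => ?_))
    change β (α (1 ⊗ₜ l)) = 1 ⊗ₜ l
    have hl : l ∈ ⨆ n, plusGrade k V n := by rw [iSup_plusGrade]; trivial
    induction hl using Submodule.iSup_induction' with
    | mem n l hl =>
      change (plusProj k V).baseChange A (E.symm (α (1 ⊗ₜ l) : FreeLie A M)) = _
      rw [hcoe n l hl, LinearEquiv.symm_apply_apply, LinearMap.baseChange_tmul, plusProj_coe]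
    | zero => rw [tmul_zero, map_zero, map_zero]
    | add l m _ _ hl hm => rw [tmul_add, map_add, map_add, hl, hm]
  -- The component along $V$ is sent by `E` into degree zero, which `plusProj` kills.
  have hαp : ∀ t, α ((plusProj k V).baseChange A t) = plusProj A M (E t) := by
    intro t
    induction t with
    | zero => simp only [map_zero]
    | add t t' ht ht' => simp only [map_add, ht, ht']
    | tmul a l =>
      change plusProj A M (E (a ⊗ₜ (plusProj k V l : FreeLie k V))) = _
      rw [coe_plusProj, tmul_sub, map_sub, map_sub, sub_eq_self]
      obtain ⟨m, hm⟩ := hE 0 (ι k V (proj k V l)) ⟨_, rfl⟩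
      rw [show a ⊗ₜ[k] ι k V (proj k V l) = a • (1 ⊗ₜ ι k V (proj k V l)) by
        rw [smul_tmul', smul_eq_mul, mul_one], map_smul, ← hm, map_smul, plusProj_ι, smul_zero]
  have hαβ : α ∘ₗ β = LinearMap.id := by
    ext1 l
    change α ((plusProj k V).baseChange A (E.symm l)) = l
    rw [hαp, LinearEquiv.apply_symm_apply, plusProj_coe]
  exact ⟨LinearEquiv.ofLinearMap α β hαβ hβα,
    fun n l hl => hgrade n _ (Submodule.tmul_mem_baseChange_of_mem 1 hl), hβgrade⟩

end FreeLie

/-- The symmetric algebra and its weight grading commute with base change. -/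
theorem nonempty_baseChange_symGrade_equiv {L L' : Type*} [AddCommGroup L] [Module k L]
    [AddCommGroup L'] [Module A L'] (E : A ⊗[k] L ≃ₗ[A] L') (ℒ : ℕ → Submodule k L)
    (ℒ' : ℕ → Submodule A L') (h : ∀ n, ∀ l ∈ ℒ n, E (1 ⊗ₜ l) ∈ ℒ' n)
    (h' : ∀ n, ∀ l ∈ ℒ' n, E.symm l ∈ (ℒ n).baseChange A) (n : ℕ) :
    Nonempty ((symGrade k ℒ n).baseChange A ≃ₗ[A] symGrade A ℒ' n) := by
  let _ : Algebra k (SymmetricAlgebra A L') := Algebra.compHom _ (algebraMap k A)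
  have : IsScalarTower k A (SymmetricAlgebra A L') := IsScalarTower.of_algebraMap_eq fun _ => rfl
  let _ : Module k L' := Module.compHom _ (algebraMap k A)
  have : IsScalarTower k A L' := IsScalarTower.of_algebraMap_smul fun _ _ => rfl
  let f₀ : SymmetricAlgebra k L →ₐ[k] SymmetricAlgebra A L' := SymmetricAlgebra.lift
    ((SymmetricAlgebra.ι A L').restrictScalars k ∘ₗ E.toLinearMap.restrictScalars k ∘ₗ
      TensorProduct.mk k A L 1)
  have hf₀ : ∀ l, f₀ (SymmetricAlgebra.ι k L l) = SymmetricAlgebra.ι A L' (E (1 ⊗ₜ l)) :=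
    fun l => SymmetricAlgebra.lift_ι_apply _ l
  let f : A ⊗[k] SymmetricAlgebra k L →ₐ[A] SymmetricAlgebra A L' :=
    Algebra.TensorProduct.lift (Algebra.ofId A _) f₀ fun _ _ => Commute.all _ _
  have hf : ∀ a s, f (a ⊗ₜ s) = a • f₀ s := fun a s => by
    rw [Algebra.TensorProduct.lift_tmul, Algebra.ofId_apply, Algebra.smul_def]
  let g : SymmetricAlgebra A L' →ₐ[A] A ⊗[k] SymmetricAlgebra k L :=
    SymmetricAlgebra.lift ((SymmetricAlgebra.ι k L).baseChange A ∘ₗ E.symm.toLinearMap)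
  have hg : ∀ l, g (SymmetricAlgebra.ι A L' l) = (SymmetricAlgebra.ι k L).baseChange A (E.symm l) :=
    fun l => SymmetricAlgebra.lift_ι_apply _ l
  have hfι : ∀ t, f ((SymmetricAlgebra.ι k L).baseChange A t) = SymmetricAlgebra.ι A L' (E t) := by
    intro t
    induction t with
    | zero => simp only [map_zero]
    | add t t' ht ht' => simp only [map_add, ht, ht']
    | tmul a l =>
      rw [LinearMap.baseChange_tmul, hf, hf₀, ← map_smul, ← map_smul, smul_tmul', smul_eq_mul,
        mul_one]
  have hfg : f.comp g = AlgHom.id A _ := by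
    refine SymmetricAlgebra.algHom_ext (LinearMap.ext fun l => ?_)
    change f (g (SymmetricAlgebra.ι A L' l)) = SymmetricAlgebra.ι A L' l
    rw [hg, hfι, LinearEquiv.apply_symm_apply]
  have hgf : g.comp f = AlgHom.id A _ := by
    refine Algebra.TensorProduct.ext (Subsingleton.elim _ _)
      (SymmetricAlgebra.algHom_ext (LinearMap.ext fun l => ?_))
    change g (f (1 ⊗ₜ SymmetricAlgebra.ι k L l)) = 1 ⊗ₜ SymmetricAlgebra.ι k L l
    rw [hf, one_smul, hf₀, hg, LinearEquiv.symm_apply_apply, LinearMap.baseChange_tmul]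
  let Θ : A ⊗[k] SymmetricAlgebra k L ≃ₐ[A] SymmetricAlgebra A L' := AlgEquiv.ofAlgHom f g hfg hgf
  have hmap : ((symGrade k ℒ n).baseChange A).map Θ.toLinearMap = symGrade A ℒ' n := by
    apply le_antisymm
    · rw [Submodule.map_le_iff_le_comap, Submodule.baseChange_eq_span, Submodule.span_le]
      rintro _ ⟨s, hs, rfl⟩
      change f (1 ⊗ₜ s) ∈ symGrade A ℒ' n
      rw [hf, one_smul]
      refine symGrade_le ℒ f₀ (symGrade A ℒ') (fun n r b hb => ?_) (fun n l hl => ?_) hs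
      · rw [← algebraMap_smul A]
        exact Submodule.smul_mem _ _ hb
      · rw [hf₀]
        exact ι_mem_symGrade _ (h n l hl)
    · intro s hs
      refine ⟨g s, ?_, DFunLike.congr_fun hfg s⟩
      refine symGrade_le ℒ' g (fun n => (symGrade k ℒ n).baseChange A)
        (fun n r b hb => Submodule.smul_mem _ r hb) (fun n l hl => ?_) hs
      rw [hg]
      exact Submodule.map_mem_baseChange _ (fun l hl => ι_mem_symGrade _ hl) (h' n l hl)
  exact ⟨(Θ.toLinearEquiv.submoduleMap _).trans (LinearEquiv.ofEq _ _ hmap)⟩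

end BaseChange

/-- Independence and spanning are properties in the lattice of submodules, which `e` carries over
isomorphically. -/
theorem isInternal_of_map_linearEquiv {R M N : Type*} [CommRing R] [AddCommGroup M] [Module R M]
    [AddCommGroup N] [Module R N] {ℳ : ℕ → Submodule R M} {𝒩 : ℕ → Submodule R N} (e : M ≃ₗ[R] N)
    (h : ∀ n, (ℳ n).map e.toLinearMap = 𝒩 n) (h𝒩 : DirectSum.IsInternal 𝒩) :
    DirectSum.IsInternal ℳ := by
  rw [DirectSum.isInternal_submodule_iff_iSupIndep_and_iSup_eq_top] at h𝒩 ⊢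
  let o : Submodule R M ≃o Submodule R N := Submodule.orderIsoMapComap e
  have ho : 𝒩 = o ∘ ℳ := funext fun n => (h n).symm
  rw [ho, iSupIndep_map_orderIso_iff] at h𝒩
  refine ⟨h𝒩.1, ?_⟩
  rw [← map_eq_top_iff o, o.map_iSup]
  exact h𝒩.2

/-! ### Local coordinates -/

theorem IsCoordinateSystem.basis_apply {k : Type u} {A : Type v} [CommRing k] [CommRing A]
    [Algebra k A] {d : ℕ} {x : Fin d → A} (h : IsCoordinateSystem k x) (i : Fin d) :
    h.basis k i = KaehlerDifferential.D k A (x i) := by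
  simp [basis]

theorem modelD_eq_productD {k : Type u} {A : Type v} [CommRing k] [CommRing A] [Algebra k A] {d : ℕ}
    {x : Fin d → A} (h : IsCoordinateSystem k x) : modelD k h =
      productD (deRhamCoord k h) (deRhamSym k x) (FreeLie.ι k (dSpan k x))
        (FreeLie.plus k (dSpan k x)).subtype := rfl

theorem modelPhi_eq {k : Type u} {A : Type v} [CommRing k] [CommRing A] [Algebra k A] {d : ℕ}
    (x : Fin d → A) : modelPhi k x = extendPairing (lieValue k A (dSpan k x)) := rfl

namespace IsCoordinateSystem

variable {k : Type u} {A : Type v} [Field k] [CommRing A] [Nontrivial A] [Algebra k A] {d : ℕ}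
  {x : Fin d → A}

/-- The basis `dx₁, …, dx_d` of the `k`-vector space `V`. -/
def dSpanBasis (h : IsCoordinateSystem k x) : Module.Basis (Fin d) k (dSpan k x) :=
  -- Independence over `A` descends to `k` because the field `k` embeds in the nontrivial ring `A`.
  Module.Basis.span (h.linearIndependent.restrict_scalars (by
    intro r s hrs
    refine FaithfulSMul.algebraMap_injective k A ?_
    simpa [Algebra.algebraMap_eq_smul_one] using hrs))

theorem coe_dSpanBasis (h : IsCoordinateSystem k x) (i : Fin d) :
    (h.dSpanBasis i : Ω[A⁄k]) = KaehlerDifferential.D k A (x i) :=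
  congrArg Subtype.val (Module.Basis.span_apply _ i)

/-- The coordinates parametrised by `V = ∑ k dxᵢ`. -/
def diffCoord (h : IsCoordinateSystem k x) : DiffCoord k A (dSpan k x) where
  -- Matches the bases $1\otimes dx_i$ and $dx_i$; the primitive of $dx_i$ is $x_i$.
  equiv := (h.dSpanBasis.baseChange A).equiv (h.basis k) (Equiv.refl _)
  primitive := h.dSpanBasis.constr k x
  equiv_tmul v := by
    induction h.dSpanBasis.mem_span v using Submodule.span_induction with
    | mem v hv =>
      obtain ⟨i, rfl⟩ := hv
      rw [Module.Basis.constr_basis, ← h.basis_apply, ← Module.Basis.baseChange_apply,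
        Module.Basis.equiv_apply, Equiv.refl_apply]
    | zero => rw [tmul_zero, map_zero, map_zero, map_zero]
    | add v w _ _ hv hw => rw [tmul_add, map_add, hv, hw, map_add, map_add]
    | smul r v _ hv =>
      rw [map_smul, Derivation.map_smul, ← hv, tmul_smul, ← algebraMap_smul A r (1 ⊗ₜ[k] v), map_smul,
        algebraMap_smul]

theorem diffCoord_equiv_symm (h : IsCoordinateSystem k x) (ω : Ω[A⁄k]) :
    h.diffCoord.equiv.symm ω = ∑ i, (h.basis k).coord i ω ⊗ₜ h.dSpanBasis i := by
  rw [LinearEquiv.symm_apply_eq, map_sum]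
  conv_lhs => rw [← (h.basis k).sum_repr ω]
  refine Finset.sum_congr rfl fun i _ => ?_
  rw [show (h.basis k).coord i ω ⊗ₜ[k] h.dSpanBasis i = (h.basis k).repr ω i • (1 ⊗ₜ h.dSpanBasis i) by
    rw [smul_tmul', smul_eq_mul, mul_one]; rfl, map_smul]
  congr 1
  rw [DiffCoord.equiv_tmul, h.basis_apply, diffCoord, Module.Basis.constr_basis]

theorem deRhamCoord_eq (h : IsCoordinateSystem k x) :
    deRhamCoord k h = (h.diffCoord.deRham : A →ₗ[k] A ⊗[k] dSpan k x) := by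
  ext a
  rw [Derivation.coeFn_coe, DiffCoord.deRham_apply, diffCoord_equiv_symm, deRhamCoord,
    LinearMap.sum_apply]
  refine Finset.sum_congr rfl fun i _ => ?_
  rw [show h.dSpanBasis i = ⟨KaehlerDifferential.D k A (x i), Submodule.subset_span ⟨i, rfl⟩⟩ from
    Subtype.ext (h.coe_dSpanBasis i)]
  rfl

theorem modelD_eq (h : IsCoordinateSystem k x) : modelD k h = h.diffCoord.lieD :=
  (modelD_eq_productD h).trans (congrArg (fun f => productD f (deRhamSym k x) (FreeLie.ι k (dSpan k x))
      (FreeLie.plus k (dSpan k x)).subtype) h.deRhamCoord_eq)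

theorem modelBr_eq (h : IsCoordinateSystem k x) : modelBr k h = h.diffCoord.lieBr :=
  congrArg₂ (fun φ D => LinearMap.compl₁₂ φ D D) (modelPhi_eq x) (modelD_eq h)

end IsCoordinateSystem

/-! ### Existence of coordinates and regular systems of parameters -/

section LocalRing

open IsLocalRing

variable (k : Type u) (A : Type v) [Field k] [CommRing A] [Algebra k A] [IsLocalRing A]

/-- Smoothness makes $\Omega^1_A$ flat, and it is finitely presented; over a local ring a basis of
such a module can be chosen inside any spanning family, here the family of all $da$. -/
theorem exists_isCoordinateSystem [Algebra.FormallySmooth k A] [Algebra.EssFiniteType k A] :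
    ∃ (d : ℕ) (x : Fin d → A), IsCoordinateSystem k x := by
  obtain ⟨κ, a, b, hb⟩ := Module.exists_basis_of_span_of_flat _
    (KaehlerDifferential.span_range_derivation k A)
  have : Finite κ := Module.Finite.finite_basis b
  obtain ⟨n, ⟨e⟩⟩ := Finite.exists_equiv_fin κ
  have hb' : (fun i => KaehlerDifferential.D k A (a (e.symm i))) = b.reindex e := by
    ext i
    rw [Module.Basis.reindex_apply, hb]
  refine ⟨n, fun i => a (e.symm i), ?_, ?_⟩
  · rw [hb']; exact (b.reindex e).linearIndependent
  · rw [hb', (b.reindex e).span_eq]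

variable {k A}

/-- If the residue field of `A` is `k`, then `A = k ⊕ 𝔪`. -/
theorem exists_algHom_sub_mem_maximalIdeal
    (hk : Function.Surjective (algebraMap k (ResidueField A))) :
    ∃ c : A →ₐ[k] k, ∀ a, a - algebraMap k A (c a) ∈ maximalIdeal A := by
  let e : k ≃ₐ[k] ResidueField A :=
    AlgEquiv.ofBijective (Algebra.ofId k _) ⟨(algebraMap k (ResidueField A)).injective, hk⟩
  refine ⟨(e.symm : ResidueField A →ₐ[k] k).comp (IsScalarTower.toAlgHom k A (ResidueField A)),
    fun a => ?_⟩
  rw [← residue_eq_zero_iff, map_sub, sub_eq_zero]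
  exact (e.apply_symm_apply (residue A a)).symm

/-- The derivation `A → 𝔪/𝔪²` which sends `a` to the class of `a - a(0)`. -/
def cotangentDerivation (c : A →ₐ[k] k) (hc : ∀ a, a - algebraMap k A (c a) ∈ maximalIdeal A) :
    Derivation k A (maximalIdeal A).Cotangent :=
  Derivation.mk' ((maximalIdeal A).toCotangent.restrictScalars k ∘ₗ
      { toFun := fun a => ⟨a - algebraMap k A (c a), hc a⟩
        map_add' := fun a b => Subtype.ext (by simp; ring)
        map_smul' := fun r a => Subtype.ext (by simp [Algebra.smul_def, mul_sub]) })
    (by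
      intro a b
      change (maximalIdeal A).toCotangent ⟨_, _⟩ = a • (maximalIdeal A).toCotangent ⟨_, _⟩ +
        b • (maximalIdeal A).toCotangent ⟨_, _⟩
      rw [← map_smul, ← map_smul, ← map_add, Ideal.toCotangent_eq]
      -- The Leibniz defect is minus the product of two elements of $\mathfrak m$, hence zero modulo
      -- $\mathfrak m^2$.
      have : (a * b - algebraMap k A (c (a * b))) -
          (a * (b - algebraMap k A (c b)) + b * (a - algebraMap k A (c a))) =
          -((a - algebraMap k A (c a)) * (b - algebraMap k A (c b))) := by
        rw [map_mul, map_mul]; ring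
      change (a * b - algebraMap k A (c (a * b))) -
          (a * (b - algebraMap k A (c b)) + b * (a - algebraMap k A (c a))) ∈ _
      rw [this, pow_two]
      exact neg_mem (Ideal.mul_mem_mul (hc a) (hc b)))

/-- The derivation $a\mapsto a-a(0)$ induces a surjection $\Omega^1_A\to\mathfrak m/\mathfrak m^2$,
so a basis of $\Omega^1_A$ yields a spanning family over the residue field. -/
theorem finrank_cotangentSpace_le [Algebra.EssFiniteType k A] [Module.Free A (Ω[A⁄k])]
    (hk : Function.Surjective (algebraMap k (ResidueField A))) :
    Module.finrank (ResidueField A) (CotangentSpace A) ≤ Module.finrank A (Ω[A⁄k]) := by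
  obtain ⟨c, hc⟩ := exists_algHom_sub_mem_maximalIdeal hk
  let δ := (cotangentDerivation c hc).liftKaehlerDifferential
  have hδ : ∀ a, δ (KaehlerDifferential.D k A a) =
      (maximalIdeal A).toCotangent ⟨a - algebraMap k A (c a), hc a⟩ :=
    fun a => (cotangentDerivation c hc).liftKaehlerDifferential_comp_D a
  have hsurj : Function.Surjective δ := by
    intro t
    obtain ⟨⟨z, hz⟩, rfl⟩ := Ideal.toCotangent_surjective _ t
    refine ⟨KaehlerDifferential.D k A z, ?_⟩
    rw [hδ]
    have hcz : c z = 0 := by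
      by_contra h
      have h1 : algebraMap k A (c z) ∈ maximalIdeal A := by
        simpa using sub_mem hz (hc z)
      exact (mem_maximalIdeal _).1 h1 ((isUnit_iff_ne_zero.2 h).map (algebraMap k A))
    simp [hcz]
  let b := Module.Free.chooseBasis A (Ω[A⁄k])
  have hspan : Submodule.span (ResidueField A) (Set.range fun i => (δ (b i) : CotangentSpace A)) = ⊤ := by
    rw [eq_top_iff]
    rintro t -
    obtain ⟨ω, rfl⟩ := hsurj t
    rw [← b.sum_repr ω, map_sum]
    refine sum_mem fun i _ => ?_
    rw [map_smul, ← algebraMap_smul (ResidueField A)]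
    exact Submodule.smul_mem _ _ (Submodule.subset_span ⟨i, rfl⟩)
  rw [Module.finrank_eq_card_chooseBasisIndex A (Ω[A⁄k])]
  exact finrank_le_of_span_eq_top hspan

/-- Constants have zero differential, so only $dz$ with $z\in\mathfrak m$ matters; writing $z$ in
terms of the $x_i$, the Leibniz rule gives $dz\in\sum A\,dx_i+\mathfrak m\Omega^1_A$, and Nakayama's
lemma concludes. -/
theorem span_range_D_eq_top [Algebra.EssFiniteType k A]
    (hk : Function.Surjective (algebraMap k (ResidueField A))) {d : ℕ} (x : Fin d → A)
    (hx : Ideal.span (Set.range x) = maximalIdeal A) :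
    Submodule.span A (Set.range fun i => KaehlerDifferential.D k A (x i)) = ⊤ := by
  obtain ⟨c, hc⟩ := exists_algHom_sub_mem_maximalIdeal hk
  let N := Submodule.span A (Set.range fun i => KaehlerDifferential.D k A (x i))
  suffices h : (⊤ : Submodule A (Ω[A⁄k])) ≤ N ⊔ maximalIdeal A • ⊤ from
    eq_top_iff.2 (Submodule.le_of_le_smul_of_le_jacobson_bot Module.Finite.fg_top
      (IsLocalRing.maximalIdeal_le_jacobson ⊥) h)
  refine (KaehlerDifferential.span_range_derivation k A).symm.trans_le (Submodule.span_le.2 ?_)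
  rintro _ ⟨a, rfl⟩
  have hm : ∀ z ∈ maximalIdeal A, KaehlerDifferential.D k A z ∈ N ⊔ maximalIdeal A • ⊤ := by
    intro z hz
    rw [← hx] at hz
    induction hz using Submodule.span_induction with
    | mem z hz =>
      obtain ⟨i, rfl⟩ := hz
      exact Submodule.mem_sup_left (Submodule.subset_span ⟨i, rfl⟩)
    | zero => rw [map_zero]; exact zero_mem _
    | add y z _ _ hy hz => rw [map_add]; exact add_mem hy hz
    | smul b z hz ih =>
      rw [smul_eq_mul, Derivation.leibniz]
      rw [show Submodule.span A (Set.range x) = maximalIdeal A from hx] at hz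
      exact add_mem (Submodule.smul_mem _ _ ih)
        (Submodule.mem_sup_right (Submodule.smul_mem_smul hz trivial))
  have := hm _ (hc a)
  rwa [map_sub, Derivation.map_algebraMap, sub_zero] at this

/-- A spanning family with at most as many members as the rank is independent. The bound comes from
$\dim A\le\dim\mathfrak m/\mathfrak m^2$; the regularity of $A$ is never invoked. -/
theorem IsRegularSystemOfParameters.isCoordinateSystem [Algebra.FormallySmooth k A]
    [Algebra.EssFiniteType k A] (hk : Function.Surjective (algebraMap k (ResidueField A))) {d : ℕ}
    {x : Fin d → A} (hx : IsRegularSystemOfParameters x) : IsCoordinateSystem k x := by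
  have hspan := span_range_D_eq_top hk x hx.2
  have : IsNoetherianRing A := Algebra.EssFiniteType.isNoetherianRing k A
  have : Module.Free A (Ω[A⁄k]) := Module.free_of_flat_of_isLocalRing
  refine ⟨linearIndependent_of_top_le_span_of_card_le_finrank hspan.ge ?_, hspan.ge⟩
  rw [Fintype.card_fin]
  refine le_trans ?_ (finrank_cotangentSpace_le hk)
  rw [← spanFinrank_maximalIdeal_eq_finrank_cotangentSpace]
  have := ringKrullDim_le_spanFinrank_maximalIdeal A
  rw [hx.1] at this
  exact_mod_cast this

end LocalRing

end

theorem theorem1p4 {k : Type u} {A : Type v} [Field k] [IsAlgClosed k] [CharZero k]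
    [CommRing A] [Algebra k A] [IsLocalRing A] [Algebra.FormallySmooth k A]
    [Algebra.EssFiniteType k A] :
    -- the grading of `PA`
    DirectSum.IsInternal (PoissonEnvelope.grade k A) ∧
    -- `PₙA` and the degree `n` part of `S^A L^A₊ Ω¹_A` are isomorphic
    (∀ n : ℕ, Nonempty (PoissonEnvelope.grade k A n ≃ₗ[A]
      symGrade A (FreeLie.plusGrade A (Ω[A⁄k])) n)) ∧
    -- there are local coordinates, and regular systems of parameters are such
    (∃ (d : ℕ) (x : Fin d → A), IsCoordinateSystem k x) ∧
    (Function.Surjective (algebraMap k (IsLocalRing.ResidueField A)) →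
      ∀ (d : ℕ) (x : Fin d → A), IsRegularSystemOfParameters x → IsCoordinateSystem k x) ∧
    -- the explicit model `A ⊗ SL₊V` of `PA`
    (∀ (d : ℕ) (x : Fin d → A) (h : IsCoordinateSystem k x),
      ∃ B : PoissonBracket k (EnvelopeModel k x),
        B.br = modelBr k h ∧
        IsPoissonEnvelope.{w} B
          (Algebra.TensorProduct.includeLeft : A →ₐ[k] EnvelopeModel k x) ∧
        ∃ e : PoissonEnvelope k A ≃ₐ[A] EnvelopeModel k x,
          (∀ p q, e ((PoissonEnvelope.poisson k A).br p q) = B.br (e p) (e q)) ∧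
          ∀ n : ℕ, (PoissonEnvelope.grade k A n).map e.toLinearMap =
            (symGrade k (FreeLie.plusGrade k (dSpan k x)) n).baseChange A) := by
  obtain ⟨d, x, h⟩ := exists_isCoordinateSystem k A
  obtain ⟨e, -, hgrade⟩ := h.diffCoord.exists_equiv
  let en (n : ℕ) : PoissonEnvelope.grade k A n ≃ₗ[A] DiffCoord.lieGrade k A (dSpan k x) n :=
    (e.toLinearEquiv.submoduleMap _).trans (LinearEquiv.ofEq _ _ (hgrade n))
  refine ⟨?_, fun n => ?_, ⟨d, x, h⟩, fun hk d x hx => hx.isCoordinateSystem hk, fun d x h => ?_⟩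
  -- Directness is proved in the model, with the scalar 2, and transported to $PA$.
  · obtain ⟨τ, hτ⟩ := FreeLie.exists_plus_scaling k (dSpan k x) 2 two_ne_zero
    have hQ := isInternal_baseChange_symGrade (A := A) _ FreeLie.iSup_plusGrade τ hτ
    exact isInternal_of_map_linearEquiv e.toLinearEquiv (fun n => hgrade n) hQ
  · obtain ⟨E, hE, hE'⟩ := FreeLie.exists_plus_baseChange_equiv h.diffCoord.equiv
    obtain ⟨F⟩ := nonempty_baseChange_symGrade_equiv E _ _ hE hE' n
    exact ⟨(en n).trans F⟩
  · exact ⟨h.diffCoord.liePoisson, h.modelBr_eq.symm, h.diffCoord.isPoissonEnvelope_liePoisson,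
      h.diffCoord.exists_equiv⟩
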